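/- **Network.** A network consists of a finite set $\mathcal M$ of subsystems with a symmetric neighbour relation ($\mathcal N_i\subseteq\mathcal M$, $i\in\mathcal N_i$) and dynamics $$x_i^+=A_ix_i+B_iu_i+\sum_{k=1}^{p}F_{i,k}\sum_{j\in\mathcal N_i\setminus i}l_{ij,k}\,(C_{j,k}x_j-C_{i,k}x_i)=A_{N_i}x_{N_i}+B_iu_i ,$$ with $x_i\in\mathbb R^{n_i}$, $n_i\ge1$, $u_i\in\mathbb R^{m_i}$, where $x_{N_i}$ stacks the states of the subsystems in $\mathcal N_i$, and constraints $x_i\in\mathcal X_i=\{G_ix_i\le g_i\}$, $u_i\in\mathcal U_i=\{H_iu_i\le h_i\}$. Let $x=[x_1;\dots;x_M]$, $u=[u_1;\dots;u_M]$, and let $U_i,V_i,W_i$ be the $0$-$1$ matrices with $x_i=U_ix$, $u_i=V_iu$, $x_{N_i}=W_ix$. Each subsystem has positive definite cost matrices $Q_i,R_i,P_i,S_i$, a terminal gain $K_i$ and $\lambda_i\in(0,1)$. Put $\bar A_i=A_{N_i}+B_iK_iU_iW_i^\top$ and $P_{ij}=W_iU_j^\top P_jU_jW_i^\top$. The scalars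 $n_{ij}$ satisfy $n_{ij}>0$ if $i\in\mathcal N_j$, $n_{ij}=0$ otherwise, and $\sum_{i}n_{ij}\le1$ for all $j$. The local matrix inequality of subsystem $i$ is $$\sum_{j\in\mathcal N_i}n_{ij}P_{ij}-W_iU_i^\top(Q_i+K_i^\top R_iK_i)U_iW_i^\top-\bar A_i^\top P_i\bar A_i\succeq0.\tag{1}$$ **Controller.** For a matrix $X$ let $[X]_k$ be the $k$-th diagonal entry, $\{X\}_k$ the sum of the absolute values in row $k$, and $|X|$ the entrywise absolute value; let $\alpha_{N_i}$ be the block diagonal matrix with blocks $\alpha_jI_{n_j}$, $j\in\mathcal N_i$. Fix a horizon $T\ge1$ and a target $(x_r,u_r)$. At the measured state $x_m$ the controller minimizes $$\sum_i\Big(\sum_{t<T}\big(\|x_i(t)-x_{e_i}\|_{Q_i}^2+\|u_i(t)-u_{e_i}\|_{R_i}^2\big)+\|x_i(T)-x_{e_i}\|_{P_i}^2+\|x_{e_i}-x_{r_i}\|_{S_i}^2\Big)$$ (where $\|v\|_X^2=v^\top Xv$) over $x_i(t),u_i(t),x_{e_i},u_{e_i},\alpha_i\ge0,c_i,d_i,b_i,\lambda_{ij}\ge0$,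 subject to $x(0)=x_m$; the dynamics; $x_i(t)\in\mathcal X_i$ for $t\le T$ and $u_i(t)\in\mathcal U_i$ for $t<T$; the equilibrium constraints $x_{e_i}=A_{N_i}x_{e_{N_i}}+B_iu_{e_i}\in\lambda_i\mathcal X_i$, $u_{e_i}=K_ix_{e_i}+d_i\in\lambda_i\mathcal U_i$; a terminal constraint $x_i(T)\in\mathcal X_{f_i}$; the invariance constraints $$2\alpha_i[P_i^{-1}]_k\ge\alpha_i\{P_i^{-1}\}_k+\sum_l(|\bar A_i|\alpha_{N_i})_{kl}+b_{i_k},\qquad -b_i\le\bar A_ic_{N_i}+B_id_i-c_i\le b_i,$$ $$2\sum_{j\in\mathcal N_i}\lambda_{ij}[P_{ij}]_k\ge\sum_{j\in\mathcal N_i}\lambda_{ij}\{P_{ij}\}_k+\sum_l(|\bar A_i|\alpha_{N_i})^\top_{kl},\qquad \alpha_i-\sum_{j\in\mathcal N_i}\lambda_{ij}\ge\sum_lb_{i_l};\tag{2}$$ and, for all rows, $G_i^kc_i+\|G_i^kP_i^{-1/2}\|_2\alpha_i\le g_i^k$ and $H_i^lK_ic_i+H_i^ld_i+\|H_i^lK_iP_i^{-1/2}\|_2\alpha_i\le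 h_i^l$. The terminal constraint is either (a) the ellipsoid $(x_i(T)-c_i)^\top P_i(x_i(T)-c_i)\le\alpha_i^2$, or (b) its polyhedral inner approximation: for some $\bar b_i$, $2\alpha_i[P_i^{-1}]_j\ge\bar b_{i_j}+\alpha_i\{P_i^{-1}\}_j$ for all $j$, $\alpha_i\ge\sum_j\bar b_{i_j}$ and $-\bar b_i\le x_i(T)-c_i\le\bar b_i$. The first input $u(0)$ of any minimizer is applied, and the problem is solved again at the next state. **Plug-and-play.** Networks $0,1,\dots,k$ arise from one another by requests. For a request let $\mathcal J$ be the set of joining and $\mathcal L$ the set of leaving subsystems, and $\mathcal Z$ the set of the remaining subsystems that have a (new) neighbour in $\mathcal J$ or had a neighbour in $\mathcal L$. Subsystems outside $\mathcal J\cup\mathcal Z$ keep their dynamics, neighbours, $K_i$ and $P_i$; those that moreover have no neighbour in $\mathcal J\cup\mathcal Z$ keep $Q_i$, $R_i$ and their $n_{ij}$. (A rejected request changes nothing.) **Assumption 1** (on network $0$). There are $\epsilon_i>0$ and diagonal positive definite $\Gamma_i\in\mathbb R^{n_i\times n_i}$, $D_i\in\mathbb R^{p\times p}$ such that for every $i$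 and all $\xi\in\mathbb R^{n_i}$, $v\in\mathbb R^p$, with $\xi^+=(A_i+B_iK_i)\xi+\sum_kF_{i,k}v_k$ and $C_i$ the matrix with rows $C_{i,k}$, $$(\xi^+)^\top P_i\xi^+-\xi^\top P_i\xi\le v^\top(C_i\xi+D_iv)-\xi^\top\Gamma_i\xi;$$ moreover $[\Gamma_i^{-1}]_j\le1/(\{C_{L_i}\}_j+\epsilon_i)$ for $j\le n_i$, $[D_i]_j\le1/\{L_{C_i}\}_j$ for all $j\le p$ with $\{L_{C_i}\}_j>0$, and (1) holds. Here $C_{L_i}$ and $L_{C_i}$ are the $i$-th block rows of $C^\top L^\top$ and $LC$, with $C=\operatorname{diag}(C_1,\dots,C_M)$, $L=\sum_kL_k\otimes e_ke_k^\top$ and $L_k$ the Laplacian with weights $l_{ij,k}$. **Theorem.** Let Assumption 1 hold for network $0$, and suppose that after each of the $k$ requests (1) holds, with the positive definite $Q_i,R_i$ that are then used as stage costs, for every subsystem in $\mathcal J$, in $\mathcal Z$ and for all their neighbours. Suppose that in the $k$-th network $0$ is an interior point of every $\mathcal X_i$ and $\mathcal U_i$, that (2) can be satisfied with all $\alpha_i>0$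 (for some $c,d,b$ and $\lambda_{ij}\ge0$), and that the target is an admissible equilibrium: $x_{r_i}=A_{N_i}x_{r_{N_i}}+B_iu_{r_i}\in\lambda_i\mathcal X_i$ and $u_{r_i}\in\lambda_i\mathcal U_i$. Then the $k$-th network under the controller is asymptotically stable to $x_r$ in the presence of constraints: there is a neighbourhood $E$ of $x_r$ on which the optimization problem is feasible (and, if all $\mathcal X_i,\mathcal U_i$ are bounded, has a minimizer) and which the closed loop does not leave; closed-loop trajectories that start in $E$ satisfy the constraints at all times and converge to $x_r$; and $x_r$ is Lyapunov stable for them. With terminal constraint (a), $E$ can be taken to be the set of all states at which the optimization problem is feasible; with terminal constraint (b), such a neighbourhood $E$ exists. -/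

import Mathlib

open Filter Topology
open scoped Matrix Pointwise

/-- The sum of the absolute values of the entries in row `j` of `X`, written `{X}_j`. -/
def rowAbs {a b : Type*} [Fintype b] (X : Matrix a b ℝ) (j : a) : ℝ := ∑ l, |X j l|

/-- The weighted squared norm `vᵀ X v`. -/
def quad {a : Type*} [Fintype a] (X : Matrix a a ℝ) (v : a → ℝ) : ℝ := v ⬝ᵥ (X *ᵥ v)

/-- A network of linear subsystems with Laplacian interconnections, polytopic constraints and
the data of a tracking model predictive controller.

`ι` is the type of labels of all subsystems that may ever take part, `M` is the set of those that
are in the network. Subsystem `i` has state dimension `n i`, input dimension `m i`, `q i` state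
constraints and `r i` input constraints; all subsystems have `p` outputs. -/
structure Network (ι : Type*) [DecidableEq ι] (n m q r : ι → ℕ) (p : ℕ) where
  /-- the subsystems of the network -/
  M : Finset ι
  /-- the neighbours of a subsystem, itself included -/
  N : ι → Finset ι
  N_subset : ∀ i ∈ M, N i ⊆ M
  self_mem_N : ∀ i ∈ M, i ∈ N i
  N_symm : ∀ i ∈ M, ∀ j ∈ M, j ∈ N i → i ∈ N j
  A : ∀ i, Matrix (Fin (n i)) (Fin (n i)) ℝ
  B : ∀ i, Matrix (Fin (n i)) (Fin (m i)) ℝ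
  /-- `F i k` is the vector through which the `k`-th interconnection acts on subsystem `i` -/
  F : ∀ i, Fin p → Fin (n i) → ℝ
  /-- `C i k` is the row vector of the `k`-th output of subsystem `i` -/
  C : ∀ i, Fin p → Fin (n i) → ℝ
  /-- `l i j k` is the weight with which the `k`-th output of `j` acts on `i` -/
  l : ι → ι → Fin p → ℝ
  G : ∀ i, Matrix (Fin (q i)) (Fin (n i)) ℝ
  g : ∀ i, Fin (q i) → ℝ
  H : ∀ i, Matrix (Fin (r i)) (Fin (m i)) ℝ
  h : ∀ i, Fin (r i) → ℝ
  /-- the feedback gain of the terminal controller `K i x + d i` -/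
  K : ∀ i, Matrix (Fin (m i)) (Fin (n i)) ℝ
  /-- terminal cost matrices -/
  P : ∀ i, Matrix (Fin (n i)) (Fin (n i)) ℝ
  /-- stage cost matrices of the states -/
  Q : ∀ i, Matrix (Fin (n i)) (Fin (n i)) ℝ
  /-- stage cost matrices of the inputs -/
  R : ∀ i, Matrix (Fin (m i)) (Fin (m i)) ℝ
  /-- cost matrices of the distance between artificial equilibrium and target -/
  S : ∀ i, Matrix (Fin (n i)) (Fin (n i)) ℝ
  P_posDef : ∀ i ∈ M, (P i).PosDef
  Q_posDef : ∀ i ∈ M, (Q i).PosDef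
  R_posDef : ∀ i ∈ M, (R i).PosDef
  S_posDef : ∀ i ∈ M, (S i).PosDef
  /-- the factor `λ_i` by which the constraints on the artificial equilibrium are tightened -/
  lam : ι → ℝ
  lam_mem : ∀ i ∈ M, lam i ∈ Set.Ioo (0 : ℝ) 1
  /-- the scalars `n_ij` -/
  w : ι → ι → ℝ
  w_pos : ∀ i ∈ M, ∀ j ∈ M, i ∈ N j → 0 < w i j
  w_zero : ∀ i ∈ M, ∀ j ∈ M, i ∉ N j → w i j = 0
  /-- The total weight that is put on `P_j` in the local inequalities is at most one. -/
  w_sum : ∀ j ∈ M, ∑ i ∈ M, w i j ≤ 1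

namespace Network

variable {ι : Type*} [DecidableEq ι] {n m q r : ι → ℕ} {p : ℕ} (ν : Network ι n m q r p)

/-- Index set of the stacked state `x = [x_1; …; x_M]`. -/
abbrev StateIdx : Type _ := Σ j : ν.M, Fin (n j)

/-- Index set of the stacked input `u = [u_1; …; u_M]`. -/
abbrev InputIdx : Type _ := Σ j : ν.M, Fin (m j)

/-- Index set of the stacked state `x_{N_i}` of the neighbours of `i`. -/
abbrev NbrIdx (i : ι) : Type _ := Σ j : ν.N i, Fin (n j)

/-- The 0-1 matrix with `x_i = U_i x`. -/
def U (i : ι) : Matrix (Fin (n i)) ν.StateIdx ℝ := fun a s =>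
  if (⟨i, a⟩ : Σ j, Fin (n j)) = ⟨s.1, s.2⟩ then 1 else 0

/-- The 0-1 matrix with `u_i = V_i u`. -/
def V (i : ι) : Matrix (Fin (m i)) ν.InputIdx ℝ := fun a s =>
  if (⟨i, a⟩ : Σ j, Fin (m j)) = ⟨s.1, s.2⟩ then 1 else 0

/-- The 0-1 matrix with `x_{N_i} = W_i x`. -/
def W (i : ι) : Matrix (ν.NbrIdx i) ν.StateIdx ℝ := fun a s =>
  if (⟨a.1, a.2⟩ : Σ j, Fin (n j)) = ⟨s.1, s.2⟩ then 1 else 0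

/-- The matrix `U_j W_iᵀ`, which selects `x_j` from `x_{N_i}` when `j` is a neighbour of `i`. -/
def sel (i j : ι) : Matrix (Fin (n j)) (ν.NbrIdx i) ℝ := ν.U j * (ν.W i)ᵀ

/-- The matrix `A_{N_i}`, for which `A_{N_i} x_{N_i}` equals
`A_i x_i + ∑_k F_{i,k} ∑_{j ∈ N_i \ i} l_{ij,k} (C_{j,k} x_j - C_{i,k} x_i)`. -/
def AN (i : ι) : Matrix (Fin (n i)) (ν.NbrIdx i) ℝ :=
  ν.A i * ν.sel i i +
    ∑ k : Fin p, ∑ j ∈ (ν.N i).erase i, ν.l i j k •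
      Matrix.vecMulVec (ν.F i k) (ν.C j k ᵥ* ν.sel i j - ν.C i k ᵥ* ν.sel i i)

/-- The terminal closed-loop matrix `A_{N_i} + B_i K_i U_i W_iᵀ`. -/
def Acl (i : ι) : Matrix (Fin (n i)) (ν.NbrIdx i) ℝ :=
  ν.AN i + ν.B i * ν.K i * ν.U i * (ν.W i)ᵀ

/-- The state constraint set of subsystem `i`. -/
def X (i : ι) : Set (Fin (n i) → ℝ) := {x | ν.G i *ᵥ x ≤ ν.g i}

/-- The input constraint set of subsystem `i`. -/
def Uset (i : ι) : Set (Fin (m i) → ℝ) := {u | ν.H i *ᵥ u ≤ ν.h i}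

/-- The stacked states `x`, `y` and the stacked input `u` satisfy `y = x⁺`, that is,
`y_i = A_{N_i} x_{N_i} + B_i u_i` for every subsystem. -/
def Next (x : ν.StateIdx → ℝ) (u : ν.InputIdx → ℝ) (y : ν.StateIdx → ℝ) : Prop :=
  ∀ i ∈ ν.M, ν.U i *ᵥ y = ν.AN i *ᵥ (ν.W i *ᵥ x) + ν.B i *ᵥ (ν.V i *ᵥ u)

/-! ### The local matrix inequality and the conditions on the initial network -/

/-- The matrix `W_i U_jᵀ P_j U_j W_iᵀ`. -/
def Pij (i j : ι) : Matrix (ν.NbrIdx i) (ν.NbrIdx i) ℝ :=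
  ν.W i * (ν.U j)ᵀ * ν.P j * ν.U j * (ν.W i)ᵀ

/-- The local matrix inequality of subsystem `i`. -/
def LocalLMI (i : ι) : Prop :=
  ((∑ j ∈ ν.N i, ν.w i j • ν.Pij i j)
    - ν.W i * (ν.U i)ᵀ * (ν.Q i + (ν.K i)ᵀ * ν.R i * ν.K i) * ν.U i * (ν.W i)ᵀ
    - (ν.Acl i)ᵀ * ν.P i * ν.Acl i).PosSemidef

/-- The Laplacian of the `k`-th interconnection graph. -/
def lap (k : Fin p) : Matrix ν.M ν.M ℝ := fun i j =>
  if i = j then ∑ j' ∈ (ν.N i).erase i, ν.l i j' k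
  else if (j : ι) ∈ ν.N i then - ν.l i j k else 0

/-- `L = ∑_k L_k ⊗ e_k e_kᵀ`. -/
def bigL : Matrix (ν.M × Fin p) (ν.M × Fin p) ℝ :=
  ∑ k : Fin p, Matrix.kroneckerMap (· * ·) (ν.lap k) (Matrix.single k k (1 : ℝ))

/-- `C = diag(C_1, …, C_M)`. -/
def bigC : Matrix (ν.M × Fin p) ν.StateIdx ℝ := fun a s =>
  if a.1 = s.1 then ν.C s.1 a.2 s.2 else 0

/-- Under `u_i = K_i x_i + d_i` and in coordinates that are shifted to an equilibrium, subsystem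
`i` is strictly passive from `Δv_i` to the virtual output `Δz_i = C_i Δx_i + D_i Δv_i`, with
storage function `Δx_iᵀ P_i Δx_i` and dissipation function `Δx_iᵀ Γ_i Δx_i`. -/
def StrictlyPassive (i : ι) (Γ : Matrix (Fin (n i)) (Fin (n i)) ℝ)
    (D : Matrix (Fin p) (Fin p) ℝ) : Prop :=
  ∀ (x : Fin (n i) → ℝ) (v : Fin p → ℝ),
    quad (ν.P i) ((ν.A i + ν.B i * ν.K i) *ᵥ x + ∑ k, v k • ν.F i k) - quad (ν.P i) x
      ≤ ∑ k, v k * (ν.C i k ⬝ᵥ x + (D *ᵥ v) k) - quad Γ x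

/-- The standing assumption on the network before any plug-and-play request: every subsystem is
strictly passive, the dissipation and feedthrough matrices are bounded through the absolute row
sums of `C_L = Cᵀ Lᵀ` and `L_C = L C`, and the local matrix inequality holds. -/
def InitialAssumption : Prop :=
  ∃ (Γ : ∀ i, Matrix (Fin (n i)) (Fin (n i)) ℝ) (D : ι → Matrix (Fin p) (Fin p) ℝ) (ε : ι → ℝ),
    ∀ i : ν.M, 0 < ε i ∧ (Γ i).IsDiag ∧ (Γ i).PosDef ∧ (D i).IsDiag ∧ (D i).PosDef ∧
      ν.StrictlyPassive i (Γ i) (D i) ∧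
      (∀ j : Fin (n i), (Γ i)⁻¹ j j ≤ 1 / (rowAbs (ν.bigCᵀ * ν.bigLᵀ) ⟨i, j⟩ + ε i)) ∧
      (∀ j : Fin p, 0 < rowAbs (ν.bigL * ν.bigC) (i, j) →
        D i j j ≤ 1 / rowAbs (ν.bigL * ν.bigC) (i, j)) ∧
      ν.LocalLMI i

/-! ### The model predictive controller -/

/-- A terminal constraint: it assigns a set to a terminal cost matrix, a centre and a size. -/
abbrev TerminalConstraint : Type :=
  ∀ d : ℕ, Matrix (Fin d) (Fin d) ℝ → (Fin d → ℝ) → ℝ → Set (Fin d → ℝ)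

/-- The ellipsoid `(x - c)ᵀ P (x - c) ≤ α²`. -/
def ellipsoid : TerminalConstraint := fun _ P c α => {x | quad P (x - c) ≤ α ^ 2}

/-- The polyhedral inner approximation of the ellipsoid that is obtained from the Schur
complement and diagonal dominance. -/
def dominated : TerminalConstraint := fun _ P c α =>
  {x | ∃ bb : Fin _ → ℝ, (∀ j, bb j + α * rowAbs P⁻¹ j ≤ 2 * α * P⁻¹ j j) ∧ ∑ j, bb j ≤ α ∧
    ∀ j, -bb j ≤ x j - c j ∧ x j - c j ≤ bb j}

/-- The decision variables of the optimal control problem. Only the values `x t` with `t ≤ T`,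
`u t` with `t < T`, `α i` with `i ∈ M` and `mu i j` with `i ∈ M`, `j ∈ N i` are constrained or
enter the cost. -/
structure Plan where
  /-- predicted states -/
  x : ℕ → ν.StateIdx → ℝ
  /-- predicted inputs -/
  u : ℕ → ν.InputIdx → ℝ
  /-- artificial equilibrium -/
  xe : ν.StateIdx → ℝ
  /-- input of the artificial equilibrium -/
  ue : ν.InputIdx → ℝ
  /-- sizes of the terminal sets -/
  α : ι → ℝ
  /-- centres of the terminal sets -/
  c : ν.StateIdx → ℝ
  /-- offsets of the terminal controllers -/
  d : ν.InputIdx → ℝ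
  /-- slack vectors -/
  b : ν.StateIdx → ℝ
  /-- multipliers -/
  mu : ι → ι → ℝ

/-- The block diagonal matrix `α_{N_i}` with the blocks `α_j I`, `j ∈ N_i`. -/
def αN (i : ι) (α : ι → ℝ) : Matrix (ν.NbrIdx i) (ν.NbrIdx i) ℝ :=
  Matrix.diagonal fun s => α s.1

/-- The constraints through which the terminal set of subsystem `i` is made invariant: diagonal
dominance of the matrix that the S-procedure yields, with the nonnegative multipliers `mu`. -/
def InvarianceConstraint (i : ι) (α : ι → ℝ) (c : ν.StateIdx → ℝ) (d : ν.InputIdx → ℝ)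
    (b : ν.StateIdx → ℝ) (mu : ι → ι → ℝ) : Prop :=
  (∀ k, α i * rowAbs (ν.P i)⁻¹ k + ∑ l, ((ν.Acl i).map abs * ν.αN i α) k l + (ν.U i *ᵥ b) k
      ≤ 2 * α i * (ν.P i)⁻¹ k k) ∧
  (∀ k, |(ν.Acl i *ᵥ (ν.W i *ᵥ c) + ν.B i *ᵥ (ν.V i *ᵥ d) - ν.U i *ᵥ c) k| ≤ (ν.U i *ᵥ b) k) ∧
  (∀ k, ∑ j ∈ ν.N i, mu i j * rowAbs (ν.Pij i j) k
        + ∑ l, ((ν.Acl i).map abs * ν.αN i α)ᵀ k l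
      ≤ 2 * ∑ j ∈ ν.N i, mu i j * ν.Pij i j k k) ∧
  ∑ k, (ν.U i *ᵥ b) k ≤ α i - ∑ j ∈ ν.N i, mu i j ∧
  ∀ j ∈ ν.N i, 0 ≤ mu i j

/-- Feasibility of a plan for horizon `T` and measured state `x₀`, with terminal constraint `Xf`.
In the last two constraints, `√(aᵀ P⁻¹ a)` is the Euclidean norm of `aᵀ P^{-1/2}`. -/
structure Feasible (Xf : TerminalConstraint) (T : ℕ) (x₀ : ν.StateIdx → ℝ) (z : ν.Plan) :
    Prop where
  init : z.x 0 = x₀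
  dyn : ∀ t < T, ν.Next (z.x t) (z.u t) (z.x (t + 1))
  state : ∀ t ≤ T, ∀ i ∈ ν.M, ν.U i *ᵥ z.x t ∈ ν.X i
  input : ∀ t < T, ∀ i ∈ ν.M, ν.V i *ᵥ z.u t ∈ ν.Uset i
  eq_dyn : ν.Next z.xe z.ue z.xe
  eq_state : ∀ i ∈ ν.M, ν.U i *ᵥ z.xe ∈ ν.lam i • ν.X i
  eq_ctrl : ∀ i ∈ ν.M, ν.V i *ᵥ z.ue = ν.K i *ᵥ (ν.U i *ᵥ z.xe) + ν.V i *ᵥ z.d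
  eq_input : ∀ i ∈ ν.M, ν.V i *ᵥ z.ue ∈ ν.lam i • ν.Uset i
  size : ∀ i ∈ ν.M, 0 ≤ z.α i
  terminal : ∀ i ∈ ν.M, ν.U i *ᵥ z.x T ∈ Xf (n i) (ν.P i) (ν.U i *ᵥ z.c) (z.α i)
  invariance : ∀ i ∈ ν.M, ν.InvarianceConstraint i z.α z.c z.d z.b z.mu
  term_state : ∀ i ∈ ν.M, ∀ k, ν.G i k ⬝ᵥ (ν.U i *ᵥ z.c)
      + √(ν.G i k ⬝ᵥ ((ν.P i)⁻¹ *ᵥ ν.G i k)) * z.α i ≤ ν.g i k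
  term_input : ∀ i ∈ ν.M, ∀ l, ν.H i l ⬝ᵥ (ν.K i *ᵥ (ν.U i *ᵥ z.c)) + ν.H i l ⬝ᵥ (ν.V i *ᵥ z.d)
      + √((ν.H i l ᵥ* ν.K i) ⬝ᵥ ((ν.P i)⁻¹ *ᵥ (ν.H i l ᵥ* ν.K i))) * z.α i ≤ ν.h i l

/-- The cost `∑_i J_i` for the target `xr`. -/
def cost (T : ℕ) (xr : ν.StateIdx → ℝ) (z : ν.Plan) : ℝ :=
  ∑ i ∈ ν.M, (∑ t ∈ Finset.range T,
      (quad (ν.Q i) (ν.U i *ᵥ z.x t - ν.U i *ᵥ z.xe)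
        + quad (ν.R i) (ν.V i *ᵥ z.u t - ν.V i *ᵥ z.ue))
    + quad (ν.P i) (ν.U i *ᵥ z.x T - ν.U i *ᵥ z.xe)
    + quad (ν.S i) (ν.U i *ᵥ z.xe - ν.U i *ᵥ xr))

/-- `z` solves the optimal control problem at the measured state `x₀`. -/
def Optimal (Xf : TerminalConstraint) (T : ℕ) (xr x₀ : ν.StateIdx → ℝ) (z : ν.Plan) : Prop :=
  ν.Feasible Xf T x₀ z ∧ ∀ z', ν.Feasible Xf T x₀ z' → ν.cost T xr z ≤ ν.cost T xr z'

/-- The states at which the optimal control problem is feasible. -/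
def feasibleStates (Xf : TerminalConstraint) (T : ℕ) : Set (ν.StateIdx → ℝ) :=
  {x₀ | ∃ z, ν.Feasible Xf T x₀ z}

/-- One step of the closed loop: at `x` the first input `u` of an optimal plan is applied, and the
network moves to `y`. (Optimal plans need not be unique; any of them may be used.) -/
def MPCStep (Xf : TerminalConstraint) (T : ℕ) (xr x : ν.StateIdx → ℝ) (u : ν.InputIdx → ℝ)
    (y : ν.StateIdx → ℝ) : Prop :=
  (∃ z, ν.Optimal Xf T xr x z ∧ z.u 0 = u) ∧ ν.Next x u y

/-- A state and input trajectory of the closed loop. -/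
def ClosedLoop (Xf : TerminalConstraint) (T : ℕ) (xr : ν.StateIdx → ℝ)
    (x : ℕ → ν.StateIdx → ℝ) (u : ℕ → ν.InputIdx → ℝ) : Prop :=
  ∀ t, ν.MPCStep Xf T xr (x t) (u t) (x (t + 1))

/-- In the presence of the constraints, the closed loop is asymptotically stable to the target
`xr` with region of attraction `E`. -/
structure AsymptoticallyStable (Xf : TerminalConstraint) (T : ℕ) (xr : ν.StateIdx → ℝ)
    (E : Set (ν.StateIdx → ℝ)) : Prop where
  /-- the region of attraction is a neighbourhood of the target -/
  nhds : E ∈ 𝓝 xr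
  /-- the optimal control problem is feasible on the region of attraction -/
  feasible : E ⊆ ν.feasibleStates Xf T
  /-- for bounded constraint sets its minimum is attained there -/
  solvable : (∀ i ∈ ν.M, Bornology.IsBounded (ν.X i) ∧ Bornology.IsBounded (ν.Uset i)) →
    ∀ x ∈ E, ∃ z, ν.Optimal Xf T xr x z
  /-- the closed loop does not leave the region of attraction -/
  invariant : ∀ x ∈ E, ∀ u y, ν.MPCStep Xf T xr x u y → y ∈ E
  /-- the constraints are satisfied along the closed loop -/
  constraints : ∀ x u, ν.ClosedLoop Xf T xr x u → x 0 ∈ E →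
    ∀ t, ∀ i ∈ ν.M, ν.U i *ᵥ x t ∈ ν.X i ∧ ν.V i *ᵥ u t ∈ ν.Uset i
  /-- Lyapunov stability of the target -/
  stable : ∀ ε > 0, ∃ δ > 0, ∀ x u, ν.ClosedLoop Xf T xr x u → x 0 ∈ E →
    dist (x 0) xr < δ → ∀ t, dist (x t) xr < ε
  /-- attractivity of the target -/
  attractive : ∀ x u, ν.ClosedLoop Xf T xr x u → x 0 ∈ E → Tendsto x atTop (𝓝 xr)

/-- The target `(xr, ur)` satisfies the constraints on artificial equilibria: it is an
equilibrium and lies in the tightened constraint sets. -/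
def AdmissibleTarget (xr : ν.StateIdx → ℝ) (ur : ν.InputIdx → ℝ) : Prop :=
  ν.Next xr ur xr ∧
    ∀ i ∈ ν.M, ν.U i *ᵥ xr ∈ ν.lam i • ν.X i ∧ ν.V i *ᵥ ur ∈ ν.lam i • ν.Uset i

/-- The invariance constraints admit terminal sets of positive sizes. -/
def NondegenerateTerminalSets : Prop :=
  ∃ α c d b mu, ∀ i ∈ ν.M, 0 < α i ∧ ν.InvarianceConstraint i α c d b mu

/-! ### Plug-and-play requests -/

section PlugAndPlay

variable (o ν : Network ι n m q r p)

/-- The subsystems that join: they are in the new network `ν` and not in the old network `o`. -/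
def joining : Finset ι := ν.M \ o.M

/-- The subsystems that leave. -/
def leaving : Finset ι := o.M \ ν.M

/-- The remaining subsystems with a joining or a leaving neighbour. -/
def affected : Finset ι :=
  {i ∈ ν.M ∩ o.M | (∃ j ∈ joining o ν, j ∈ ν.N i) ∨ ∃ j ∈ leaving o ν, j ∈ o.N i}

/-- The joining and the affected subsystems, together with all their neighbours. -/
def redesignSet : Finset ι :=
  (joining o ν ∪ affected o ν) ∪ (joining o ν ∪ affected o ν).biUnion ν.N

/-- The network `ν` arises from the network `o` through a plug-and-play request: subsystems that
are neither joining nor affected keep their dynamics, neighbours and terminal ingredients, and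
those that moreover have no joining or affected neighbour keep their stage costs and their
scalars `n_ij`. (A rejected request, after which `ν = o`, is included.) -/
structure PnPRequest : Prop where
  keep : ∀ i ∈ ν.M, i ∉ joining o ν ∪ affected o ν →
    ν.A i = o.A i ∧ ν.B i = o.B i ∧ ν.F i = o.F i ∧ ν.C i = o.C i ∧ ν.N i = o.N i ∧
    (∀ j ∈ ν.N i, ν.l i j = o.l i j) ∧ ν.K i = o.K i ∧ ν.P i = o.P i
  keep_cost : ∀ i ∈ ν.M, i ∉ redesignSet o ν →
    ν.Q i = o.Q i ∧ ν.R i = o.R i ∧ ∀ j ∈ ν.N i, ν.w i j = o.w i j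

end PlugAndPlay

end Network

/-! The total terminal cost `V(e) = ∑ ‖e_i‖²_{P_i}` is a Lyapunov function of the terminal feedback.
Summing (1) over all subsystems, and using that the weights placed on each `P_j` add up to at most
one, gives `V(e⁺)` plus the stage cost at most `V(e)` (`total_clStep_le`). Inequality (1) survives
the requests, because a subsystem outside the redesigned set has no joining or affected neighbour,
so that every datum in its inequality is unchanged (`PnPRequest.localLMI`).

Consequently an optimal plan can be shifted by one step and continued with the terminal controller,
and the cost drops by at least the first stage cost (`Feasible.shift`). The continuation must be
feasible. For (a), the constraints (2) make the ellipsoids jointly invariant: a Schur complement and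
an S-procedure, both certified by diagonal dominance (`InvarianceConstraint.quad_le`). This works at
every feasible state. For (b), that argument only puts the successor into the ellipsoid, not into
its polyhedral approximation. Instead, (2) is homogeneous and an admissible equilibrium leaves a
margin `1 - λ_i` in the constraints, so terminal sets of one fixed small size can be centred at any
admissible equilibrium (`exists_uniform_terminal`). They capture the end of every plan of small
cost, and `E` is a sublevel set of the optimal cost.

Lyapunov stability follows by bounding the cost from below by `x - x_e` and `x_e - x_r`, and from
above, near the target, by `V(x - x_r)`. For attractivity, the decrease of the cost forces `x - x_e
→ 0` but says nothing about `x_e - x_r`. Once `x` is close to `x_e`, a feasible competitor moves the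
artificial equilibrium by a fixed fraction `β` towards the target. The offset cost drops to first
order in `β` while the tracking cost grows to second order, so optimality forces `x_e → x_r`
(`asymptoticallyStable_of_decrease`).

Minimizers exist by compactness: bounded constraint sets bound all decision variables that matter,
and the others may be set to zero (`exists_optimal`). -/

/-! ### Quadratic forms, diagonal dominance and ellipsoids -/

section Quad

variable {a b : Type*} [Fintype a] [Fintype b]

lemma quad_eq_sum (X : Matrix a a ℝ) (v : a → ℝ) :
    quad X v = ∑ k, ∑ l, X k l * v k * v l := by
  simp only [quad, dotProduct, Matrix.mulVec, Finset.mul_sum]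
  exact Finset.sum_congr rfl fun k _ => Finset.sum_congr rfl fun l _ => by ring

@[simp] lemma quad_zero (X : Matrix a a ℝ) : quad X 0 = 0 := by simp [quad]

lemma quad_smul (X : Matrix a a ℝ) (t : ℝ) (v : a → ℝ) : quad X (t • v) = t ^ 2 * quad X v := by
  simp only [quad, Matrix.mulVec_smul, smul_dotProduct, dotProduct_smul, smul_eq_mul]; ring

lemma continuous_quad (X : Matrix a a ℝ) : Continuous (quad X) := by
  have : quad X = fun v => ∑ k, ∑ l, X k l * v k * v l := funext (quad_eq_sum X)
  rw [this]; fun_prop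

lemma quad_conj (X : Matrix a a ℝ) (Y : Matrix a b ℝ) (v : b → ℝ) :
    quad (Yᵀ * X * Y) v = quad X (Y *ᵥ v) := by
  simp only [quad, ← Matrix.mulVec_mulVec, Matrix.dotProduct_mulVec, Matrix.vecMul_transpose]

lemma quad_nonneg {X : Matrix a a ℝ} (h : X.PosDef) (v : a → ℝ) : 0 ≤ quad X v := by
  simpa [quad] using h.posSemidef.dotProduct_mulVec_nonneg v

lemma quad_pos {X : Matrix a a ℝ} (h : X.PosDef) {v : a → ℝ} (hv : v ≠ 0) : 0 < quad X v := by
  simpa [quad] using h.dotProduct_mulVec_pos hv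

lemma eq_zero_of_quad_nonpos {X : Matrix a a ℝ} (h : X.PosDef) {v : a → ℝ} (hv : quad X v ≤ 0) :
    v = 0 := by
  by_contra hne
  exact absurd (quad_pos h hne) (not_lt.mpr hv)

lemma quad_add_le {X : Matrix a a ℝ} (h : X.PosDef) (v w : a → ℝ) :
    quad X (v + w) ≤ 2 * quad X v + 2 * quad X w := by
  have h1 := quad_nonneg h (v - w)
  simp only [quad, Matrix.mulVec_add, Matrix.mulVec_sub, dotProduct_add, add_dotProduct,
    dotProduct_sub, sub_dotProduct] at *
  linarith

/-- Weak diagonal dominance bounds a quadratic form from below. -/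
lemma sum_dominance_le_quad [DecidableEq a] {X : Matrix a a ℝ} (hX : X.IsHermitian) (v : a → ℝ) :
    ∑ k, (2 * X k k - rowAbs X k) * v k ^ 2 ≤ quad X v := by
  have hsymm : ∀ k l, X k l = X l k := fun k l => by
    have := congrFun (congrFun hX.eq l) k
    simpa using this
  -- By symmetry of `X`, the weight `|X k l|` can be shared equally between `v k ^ 2` and `v l ^ 2`.
  -- The comparison then holds entry by entry, by the inequality of arithmetic and geometric means.
  have h1 : ∑ k, rowAbs X k * v k ^ 2 = ∑ k, ∑ l, |X k l| * (v k ^ 2 + v l ^ 2) / 2 := by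
    have e1 : ∑ k, rowAbs X k * v k ^ 2 = ∑ k, ∑ l, |X k l| * v k ^ 2 := by
      simp [rowAbs, Finset.sum_mul]
    have e2 : ∑ k, ∑ l, |X k l| * v k ^ 2 = ∑ k, ∑ l, |X k l| * v l ^ 2 := by
      rw [Finset.sum_comm]
      exact Finset.sum_congr rfl fun k _ => Finset.sum_congr rfl fun l _ => by rw [hsymm]
    have e3 : ∑ k, ∑ l, |X k l| * (v k ^ 2 + v l ^ 2) / 2
        = (∑ k, ∑ l, |X k l| * v k ^ 2 + ∑ k, ∑ l, |X k l| * v l ^ 2) / 2 := by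
      simp only [← Finset.sum_add_distrib, Finset.sum_div]
      exact Finset.sum_congr rfl fun k _ => Finset.sum_congr rfl fun l _ => by ring
    rw [e1, e3, ← e2]; ring
  have h2 : ∑ k, 2 * X k k * v k ^ 2
      = ∑ k, ∑ l, if k = l then 2 * X k k * v k ^ 2 else 0 := by simp
  simp only [sub_mul, Finset.sum_sub_distrib]
  rw [h1, h2, quad_eq_sum, ← Finset.sum_sub_distrib]
  refine Finset.sum_le_sum fun k _ => ?_
  rw [← Finset.sum_sub_distrib]
  refine Finset.sum_le_sum fun l _ => ?_
  have hab : -(|X k l| * (v k ^ 2 + v l ^ 2) / 2) ≤ X k l * v k * v l := by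
    have h3 : |X k l * v k * v l| ≤ |X k l| * (v k ^ 2 + v l ^ 2) / 2 := by
      rw [abs_mul, abs_mul, mul_assoc, mul_div_assoc]
      refine mul_le_mul_of_nonneg_left ?_ (abs_nonneg _)
      nlinarith [sq_nonneg (|v k| - |v l|), sq_abs (v k), sq_abs (v l)]
    exact (abs_le.mp h3).1
  -- A diagonal entry contributes `2 X k k - |X k k|`, which is at most `X k k` whatever its sign.
  split_ifs with hkl
  · subst hkl
    nlinarith [le_abs_self (X k k), sq_nonneg (v k)]
  · linarith

variable [DecidableEq a]

lemma quad_inv_mulVec {X : Matrix a a ℝ} (h : X.PosDef) (y : a → ℝ) :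
    quad X⁻¹ (X *ᵥ y) = quad X y := by
  have hdet : IsUnit X.det := (Matrix.isUnit_iff_isUnit_det X).mp h.isUnit
  simp only [quad, Matrix.mulVec_mulVec, Matrix.nonsing_inv_mul X hdet, Matrix.one_mulVec]
  exact dotProduct_comm _ _

/-- The Schur complement argument for the ellipsoid of radius `α`. -/
lemma quad_le_sq_of_forall {X : Matrix a a ℝ} (h : X.PosDef) {α : ℝ} (hα : 0 ≤ α) {y : a → ℝ}
    (hv : ∀ v, 0 ≤ α * quad X⁻¹ v + 2 * (v ⬝ᵥ y) + α) : quad X y ≤ α ^ 2 := by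
  -- Testing with `v = -t X y` turns the hypothesis into a quadratic in `t`. For `α > 0` its minimum
  -- is at `t = α⁻¹`; for `α = 0` any positive `t` shows that the form vanishes.
  have key : ∀ t : ℝ, 0 ≤ α * (t ^ 2 * quad X y) - 2 * t * quad X y + α := fun t => by
    have := hv ((-t) • (X *ᵥ y))
    rw [quad_smul, quad_inv_mulVec h, smul_dotProduct, dotProduct_comm (X *ᵥ y) y] at this
    have e : y ⬝ᵥ X *ᵥ y = quad X y := rfl
    rw [e, smul_eq_mul] at this
    nlinarith
  have hq := quad_nonneg h y
  rcases hα.eq_or_lt with h0 | h0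
  · have := key 1
    rw [← h0] at this ⊢
    nlinarith
  · have := key α⁻¹
    have e : α * (α⁻¹ ^ 2 * quad X y) = α⁻¹ * quad X y := by field_simp
    rw [e] at this
    have h2 : α⁻¹ * quad X y ≤ α := by linarith
    rw [inv_mul_le_iff₀ h0] at h2
    nlinarith

/-- A linear functional on the ellipsoid of radius `α`. -/
lemma dotProduct_le_of_quad_le {X : Matrix a a ℝ} (h : X.PosDef) {α : ℝ} (hα : 0 ≤ α)
    {y : a → ℝ} (hy : quad X y ≤ α ^ 2) (f : a → ℝ) :
    f ⬝ᵥ y ≤ √(f ⬝ᵥ (X⁻¹ *ᵥ f)) * α := by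
  have hdet : IsUnit X.det := (Matrix.isUnit_iff_isUnit_det X).mp h.isUnit
  -- `g` represents the functional `f` in the inner product of `X`, so the claim is the
  -- Cauchy-Schwarz inequality, obtained below from a discriminant.
  set g := X⁻¹ *ᵥ f with hg
  have hXg : X *ᵥ g = f := by
    rw [hg, Matrix.mulVec_mulVec, Matrix.mul_nonsing_inv X hdet, Matrix.one_mulVec]
  have hfg : f ⬝ᵥ g = quad X g := by rw [quad, hXg, dotProduct_comm]
  have hsymm : g ⬝ᵥ X *ᵥ y = y ⬝ᵥ X *ᵥ g := by
    have ht : Xᵀ = X := by simpa using h.isHermitian.eq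
    rw [Matrix.dotProduct_mulVec, ← Matrix.mulVec_transpose, ht, dotProduct_comm]
  have hfy : f ⬝ᵥ y = y ⬝ᵥ X *ᵥ g := by rw [hXg, dotProduct_comm]
  have hquad : ∀ t : ℝ, 0 ≤ quad X y * (t * t) + 2 * (f ⬝ᵥ y) * t + quad X g := fun t => by
    have := quad_nonneg h (t • y + g)
    simp only [quad, Matrix.mulVec_add, Matrix.mulVec_smul, dotProduct_add, add_dotProduct,
      smul_dotProduct, dotProduct_smul, smul_eq_mul, hsymm, ← hfy] at this ⊢
    linarith
  have hd := discrim_le_zero hquad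
  rw [discrim] at hd
  have hg0 := quad_nonneg h g
  have hsq : (f ⬝ᵥ y) ^ 2 ≤ (√(f ⬝ᵥ g) * α) ^ 2 := by
    rw [mul_pow, Real.sq_sqrt (by rw [hfg]; exact hg0), hfg]
    nlinarith
  exact (abs_le_of_sq_le_sq' hsq (by positivity)).2

end Quad

/-- Upper and lower bounds of a definite quadratic function by the squared norm. -/
lemma exists_quadratic_bounds {κ : Type*} [Fintype κ] {f : (κ → ℝ) → ℝ} (hc : Continuous f)
    (hs : ∀ (t : ℝ) x, f (t • x) = t ^ 2 * f x) (hp : ∀ x, x ≠ 0 → 0 < f x) :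
    ∃ c C : ℝ, 0 < c ∧ 0 < C ∧ ∀ x, c * ‖x‖ ^ 2 ≤ f x ∧ f x ≤ C * ‖x‖ ^ 2 := by
  have h0 : f 0 = 0 := by simpa using hs 0 0
  -- The unit sphere is empty when the space is trivial; any positive constants do in that case.
  by_cases hne : (Metric.sphere (0 : κ → ℝ) 1).Nonempty
  · obtain ⟨x₁, hx₁, h₁⟩ := (isCompact_sphere (0 : κ → ℝ) 1).exists_isMinOn hne hc.continuousOn
    obtain ⟨x₂, hx₂, h₂⟩ := (isCompact_sphere (0 : κ → ℝ) 1).exists_isMaxOn hne hc.continuousOn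
    have pos : ∀ x ∈ Metric.sphere (0 : κ → ℝ) 1, 0 < f x := fun x hx => hp x (by
      rintro rfl; simp at hx)
    refine ⟨f x₁, f x₂, pos x₁ hx₁, pos x₂ hx₂, fun x => ?_⟩
    rcases eq_or_ne x 0 with rfl | hx
    · simp [h0]
    · have hn : ‖x‖ ≠ 0 := norm_ne_zero_iff.mpr hx
      have hmem : ‖x‖⁻¹ • x ∈ Metric.sphere (0 : κ → ℝ) 1 := by
        simp [norm_smul, hn]
      have e : f x = ‖x‖ ^ 2 * f (‖x‖⁻¹ • x) := by
        rw [hs]; field_simp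
      have h3 : f x₁ ≤ f (‖x‖⁻¹ • x) := h₁ hmem
      have h4 : f (‖x‖⁻¹ • x) ≤ f x₂ := h₂ hmem
      rw [e]
      constructor <;> nlinarith [sq_nonneg ‖x‖]
  · refine ⟨1, 1, one_pos, one_pos, fun x => ?_⟩
    have hx : x = 0 := by
      by_contra hx
      exact hne ⟨‖x‖⁻¹ • x, by simp [norm_smul, norm_ne_zero_iff.mpr hx]⟩
    simp [hx, h0]

namespace Network

/-! ### Selection matrices, and the local matrix inequality as an inequality of quadratic forms -/

section Select

variable {ι : Type*} [DecidableEq ι]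

lemma sum_select {n : ι → ℕ} {S : Finset ι} {i : ι} (hi : i ∈ S) (a : Fin (n i))
    (f : (Σ j : S, Fin (n j)) → ℝ) :
    ∑ s, (if (⟨i, a⟩ : Σ j, Fin (n j)) = ⟨s.1, s.2⟩ then (1 : ℝ) else 0) * f s
      = f ⟨⟨i, hi⟩, a⟩ := by
  rw [Finset.sum_eq_single (⟨⟨i, hi⟩, a⟩ : Σ j : S, Fin (n j))]
  · simp
  · rintro ⟨⟨j, hj⟩, b⟩ _ hne
    rw [if_neg, zero_mul]
    intro h
    apply hne
    obtain ⟨rfl, h2⟩ := Sigma.mk.inj_iff.mp h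
    rw [eq_of_heq h2]
  · simp

variable {n m q r : ι → ℕ} {p : ℕ} (ν : Network ι n m q r p)

lemma U_mulVec {i : ι} (hi : i ∈ ν.M) (x : ν.StateIdx → ℝ) :
    ν.U i *ᵥ x = fun a => x ⟨⟨i, hi⟩, a⟩ :=
  funext fun a => sum_select hi a x

lemma V_mulVec {i : ι} (hi : i ∈ ν.M) (u : ν.InputIdx → ℝ) :
    ν.V i *ᵥ u = fun a => u ⟨⟨i, hi⟩, a⟩ :=
  funext fun a => sum_select hi a u

lemma W_mulVec {i : ι} (hi : i ∈ ν.M) (x : ν.StateIdx → ℝ) :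
    ν.W i *ᵥ x = fun s => x ⟨⟨s.1, ν.N_subset i hi s.1.2⟩, s.2⟩ :=
  funext fun s => sum_select (ν.N_subset i hi s.1.2) s.2 x

lemma sel_mulVec {i j : ι} (hi : i ∈ ν.M) (hj : j ∈ ν.N i) (y : ν.NbrIdx i → ℝ) :
    ν.sel i j *ᵥ y = fun a => y ⟨⟨j, hj⟩, a⟩ := by
  rw [sel, ← Matrix.mulVec_mulVec, ν.U_mulVec (ν.N_subset i hi hj)]
  funext a
  rw [← sum_select hj a y]
  refine Finset.sum_congr rfl fun s _ => ?_
  simp only [Matrix.transpose_apply, W]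
  congr 1
  exact if_congr eq_comm rfl rfl

lemma sel_mulVec_W {i j : ι} (hi : i ∈ ν.M) (hj : j ∈ ν.N i) (x : ν.StateIdx → ℝ) :
    ν.sel i j *ᵥ (ν.W i *ᵥ x) = ν.U j *ᵥ x := by
  rw [ν.sel_mulVec hi hj, ν.W_mulVec hi, ν.U_mulVec (ν.N_subset i hi hj)]

lemma ext_U {x y : ν.StateIdx → ℝ} (h : ∀ i ∈ ν.M, ν.U i *ᵥ x = ν.U i *ᵥ y) : x = y := by
  funext ⟨⟨i, hi⟩, a⟩
  have := congrFun (h i hi) a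
  rwa [ν.U_mulVec hi, ν.U_mulVec hi] at this

lemma ext_V {x y : ν.InputIdx → ℝ} (h : ∀ i ∈ ν.M, ν.V i *ᵥ x = ν.V i *ᵥ y) : x = y := by
  funext ⟨⟨i, hi⟩, a⟩
  have := congrFun (h i hi) a
  rwa [ν.V_mulVec hi, ν.V_mulVec hi] at this

lemma Pij_eq (i j : ι) : ν.Pij i j = (ν.sel i j)ᵀ * ν.P j * ν.sel i j := by
  simp only [Pij, sel, Matrix.transpose_mul, Matrix.transpose_transpose, Matrix.mul_assoc]

lemma quad_Pij (i j : ι) (y : ν.NbrIdx i → ℝ) :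
    quad (ν.Pij i j) y = quad (ν.P j) (ν.sel i j *ᵥ y) := by
  rw [Pij_eq, quad_conj]

lemma Pij_isHermitian {i j : ι} (hj : j ∈ ν.M) : (ν.Pij i j).IsHermitian := by
  rw [Pij_eq]
  simpa [Matrix.conjTranspose_eq_transpose_of_trivial] using
    Matrix.isHermitian_conjTranspose_mul_mul (ν.sel i j) (ν.P_posDef j hj).isHermitian

lemma AN_mulVec (i : ι) (y : ν.NbrIdx i → ℝ) :
    ν.AN i *ᵥ y = ν.A i *ᵥ (ν.sel i i *ᵥ y) + ∑ k : Fin p, ∑ j ∈ (ν.N i).erase i,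
      (ν.l i j k * (ν.C j k ⬝ᵥ (ν.sel i j *ᵥ y) - ν.C i k ⬝ᵥ (ν.sel i i *ᵥ y))) • ν.F i k := by
  simp only [AN, Matrix.add_mulVec, Matrix.sum_mulVec, Matrix.smul_mulVec, Matrix.mulVec_mulVec,
    Matrix.vecMulVec_mulVec, sub_dotProduct, ← Matrix.dotProduct_mulVec, mul_smul,
    op_smul_eq_smul]

lemma Acl_mulVec (i : ι) (y : ν.NbrIdx i → ℝ) :
    ν.Acl i *ᵥ y = ν.AN i *ᵥ y + ν.B i *ᵥ (ν.K i *ᵥ (ν.sel i i *ᵥ y)) := by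
  simp only [Acl, Matrix.add_mulVec, Matrix.mulVec_mulVec, sel, Matrix.mul_assoc]

/-- The quadratic form of the local matrix inequality. -/
lemma quad_LMI (i : ι) (y : ν.NbrIdx i → ℝ) :
    quad ((∑ j ∈ ν.N i, ν.w i j • ν.Pij i j)
      - ν.W i * (ν.U i)ᵀ * (ν.Q i + (ν.K i)ᵀ * ν.R i * ν.K i) * ν.U i * (ν.W i)ᵀ
      - (ν.Acl i)ᵀ * ν.P i * ν.Acl i) y
    = (∑ j ∈ ν.N i, ν.w i j * quad (ν.P j) (ν.sel i j *ᵥ y))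
      - quad (ν.Q i) (ν.sel i i *ᵥ y) - quad (ν.R i) (ν.K i *ᵥ (ν.sel i i *ᵥ y))
      - quad (ν.P i) (ν.Acl i *ᵥ y) := by
  have e : ν.W i * (ν.U i)ᵀ * (ν.Q i + (ν.K i)ᵀ * ν.R i * ν.K i) * ν.U i * (ν.W i)ᵀ
      = (ν.sel i i)ᵀ * ν.Q i * ν.sel i i
        + (ν.K i * ν.sel i i)ᵀ * ν.R i * (ν.K i * ν.sel i i) := by
    simp only [sel, Matrix.transpose_mul, Matrix.transpose_transpose, Matrix.mul_assoc,
      Matrix.add_mul, Matrix.mul_add]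
  rw [e]
  have hsub : ∀ (X Y : Matrix (ν.NbrIdx i) (ν.NbrIdx i) ℝ), quad (X - Y) y = quad X y - quad Y y :=
    fun X Y => by simp [quad, Matrix.sub_mulVec]
  have hadd : ∀ (X Y : Matrix (ν.NbrIdx i) (ν.NbrIdx i) ℝ), quad (X + Y) y = quad X y + quad Y y :=
    fun X Y => by simp [quad, Matrix.add_mulVec]
  have hsum : quad (∑ j ∈ ν.N i, ν.w i j • ν.Pij i j) y
      = ∑ j ∈ ν.N i, ν.w i j * quad (ν.P j) (ν.sel i j *ᵥ y) := by
    simp only [← quad_Pij]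
    simp [quad, Matrix.sum_mulVec, Matrix.smul_mulVec, dotProduct_sum]
  rw [hsub, hsub, hadd, hsum, quad_conj, quad_conj, quad_conj, ← Matrix.mulVec_mulVec]
  ring

/-- Symmetry of the matrix is automatic from that of `P`, `Q` and `R`, so only its quadratic form
carries information. -/
lemma localLMI_iff {i : ι} (hi : i ∈ ν.M) : ν.LocalLMI i ↔ ∀ y : ν.NbrIdx i → ℝ,
    quad (ν.Q i) (ν.sel i i *ᵥ y) + quad (ν.R i) (ν.K i *ᵥ (ν.sel i i *ᵥ y))
      + quad (ν.P i) (ν.Acl i *ᵥ y)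
      ≤ ∑ j ∈ ν.N i, ν.w i j * quad (ν.P j) (ν.sel i j *ᵥ y) := by
  have hherm : ((∑ j ∈ ν.N i, ν.w i j • ν.Pij i j)
      - ν.W i * (ν.U i)ᵀ * (ν.Q i + (ν.K i)ᵀ * ν.R i * ν.K i) * ν.U i * (ν.W i)ᵀ
      - (ν.Acl i)ᵀ * ν.P i * ν.Acl i).IsHermitian := by
    have hP := (ν.P_posDef i hi).isHermitian.eq
    have hQ := (ν.Q_posDef i hi).isHermitian.eq
    have hR := (ν.R_posDef i hi).isHermitian.eq
    rw [Matrix.conjTranspose_eq_transpose_of_trivial] at hP hQ hR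
    refine Matrix.IsHermitian.sub (Matrix.IsHermitian.sub ?_ ?_) ?_
    · rw [Matrix.IsHermitian, Matrix.conjTranspose_sum]
      refine Finset.sum_congr rfl fun j hj => ?_
      rw [Matrix.conjTranspose_smul, (ν.Pij_isHermitian (ν.N_subset i hi hj)).eq]
      simp
    · rw [Matrix.IsHermitian, Matrix.conjTranspose_eq_transpose_of_trivial]
      simp only [Matrix.transpose_mul, Matrix.transpose_transpose, Matrix.transpose_add, hQ, hR,
        Matrix.mul_assoc]
    · rw [Matrix.IsHermitian, Matrix.conjTranspose_eq_transpose_of_trivial]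
      simp only [Matrix.transpose_mul, Matrix.transpose_transpose, hP, Matrix.mul_assoc]
  rw [LocalLMI, Matrix.posSemidef_iff_dotProduct_mulVec]
  constructor
  · rintro ⟨-, h⟩ y
    have h1 := h y
    rw [star_trivial] at h1
    have := ν.quad_LMI i y
    rw [quad] at this
    linarith
  · refine fun h => ⟨hherm, fun y => ?_⟩
    rw [star_trivial]
    have := ν.quad_LMI i y
    rw [quad] at this
    linarith [h y]

/-- The local matrix inequality in terms of one vector per subsystem. -/
lemma localLMI_iff_forall {i : ι} (hi : i ∈ ν.M) : ν.LocalLMI i ↔ ∀ ξ : ∀ j, Fin (n j) → ℝ,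
    quad (ν.Q i) (ξ i) + quad (ν.R i) (ν.K i *ᵥ ξ i)
      + quad (ν.P i) (ν.A i *ᵥ ξ i + ∑ k : Fin p, ∑ j ∈ (ν.N i).erase i,
          (ν.l i j k * (ν.C j k ⬝ᵥ ξ j - ν.C i k ⬝ᵥ ξ i)) • ν.F i k + ν.B i *ᵥ (ν.K i *ᵥ ξ i))
      ≤ ∑ j ∈ ν.N i, ν.w i j * quad (ν.P j) (ξ j) := by
  -- The index type of `y` depends on the network, whereas that of `ξ` does not. In terms of `ξ` the
  -- inequalities of two different networks can be compared directly.
  have key : ∀ (ξ : ∀ j, Fin (n j) → ℝ) (y : ν.NbrIdx i → ℝ),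
      (∀ j ∈ ν.N i, ν.sel i j *ᵥ y = ξ j) →
      ((quad (ν.Q i) (ν.sel i i *ᵥ y) + quad (ν.R i) (ν.K i *ᵥ (ν.sel i i *ᵥ y))
        + quad (ν.P i) (ν.Acl i *ᵥ y)
        ≤ ∑ j ∈ ν.N i, ν.w i j * quad (ν.P j) (ν.sel i j *ᵥ y)) ↔
      (quad (ν.Q i) (ξ i) + quad (ν.R i) (ν.K i *ᵥ ξ i)
      + quad (ν.P i) (ν.A i *ᵥ ξ i + ∑ k : Fin p, ∑ j ∈ (ν.N i).erase i,
          (ν.l i j k * (ν.C j k ⬝ᵥ ξ j - ν.C i k ⬝ᵥ ξ i)) • ν.F i k + ν.B i *ᵥ (ν.K i *ᵥ ξ i))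
      ≤ ∑ j ∈ ν.N i, ν.w i j * quad (ν.P j) (ξ j))) := fun ξ y hy => by
    have e1 : ∑ j ∈ ν.N i, ν.w i j * quad (ν.P j) (ν.sel i j *ᵥ y)
        = ∑ j ∈ ν.N i, ν.w i j * quad (ν.P j) (ξ j) :=
      Finset.sum_congr rfl fun j hj => by rw [hy j hj]
    have e2 : ν.AN i *ᵥ y = ν.A i *ᵥ ξ i + ∑ k : Fin p, ∑ j ∈ (ν.N i).erase i,
        (ν.l i j k * (ν.C j k ⬝ᵥ ξ j - ν.C i k ⬝ᵥ ξ i)) • ν.F i k := by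
      rw [AN_mulVec, hy i (ν.self_mem_N i hi)]
      congr 1
      refine Finset.sum_congr rfl fun k _ => Finset.sum_congr rfl fun j hj => ?_
      rw [hy j (Finset.mem_of_mem_erase hj)]
    rw [e1, Acl_mulVec, e2, hy i (ν.self_mem_N i hi)]
  rw [ν.localLMI_iff hi]
  constructor
  · intro h ξ
    refine (key ξ (fun s => ξ s.1 s.2) fun j hj => ?_).mp (h _)
    rw [ν.sel_mulVec hi hj]
  · intro h y
    obtain ⟨ξ, hξ⟩ : ∃ ξ : ∀ j, Fin (n j) → ℝ, ∀ j ∈ ν.N i, ν.sel i j *ᵥ y = ξ j := by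
      refine ⟨fun j a => if hj : j ∈ ν.N i then y ⟨⟨j, hj⟩, a⟩ else 0, fun j hj => ?_⟩
      rw [ν.sel_mulVec hi hj]
      simp [hj]
    exact (key ξ y hξ).mpr (h ξ)

end Select

/-! ### Persistence of the local matrix inequalities under requests -/

section Requests

variable {ι : Type*} [DecidableEq ι] {n m q r : ι → ℕ} {p : ℕ}

/-- A subsystem outside the redesign set keeps its local matrix inequality. -/
lemma PnPRequest.localLMI {o ν : Network ι n m q r p} (h : PnPRequest o ν) {i : ι}
    (hi : i ∈ ν.M) (hout : i ∉ redesignSet o ν) (hlmi : i ∈ o.M → o.LocalLMI i) :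
    ν.LocalLMI i := by
  -- The redesigned set contains the neighbours of joining and affected subsystems. Since the
  -- neighbour relation is symmetric, lying outside it means having no such neighbour.
  have hnot : ∀ j ∈ ν.N i, j ∉ joining o ν ∪ affected o ν := fun j hj hmem =>
    hout (Finset.mem_union_right _ (Finset.mem_biUnion.mpr
      ⟨j, hmem, ν.N_symm i hi j (ν.N_subset i hi hj) hj⟩))
  have hii := hnot i (ν.self_mem_N i hi)
  have hio : i ∈ o.M := by
    by_contra hio
    exact hii (Finset.mem_union_left _ (Finset.mem_sdiff.mpr ⟨hi, hio⟩))
  obtain ⟨hA, hB, hF, hC, hN, hl, hK, hP⟩ := h.keep i hi hii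
  obtain ⟨hQ, hR, hw⟩ := h.keep_cost i hi hout
  have hCj : ∀ j ∈ ν.N i, ν.C j = o.C j := fun j hj =>
    (h.keep j (ν.N_subset i hi hj) (hnot j hj)).2.2.2.1
  have hPj : ∀ j ∈ ν.N i, ν.P j = o.P j := fun j hj =>
    (h.keep j (ν.N_subset i hi hj) (hnot j hj)).2.2.2.2.2.2.2
  rw [ν.localLMI_iff_forall hi]
  intro ξ
  have h1 := (o.localLMI_iff_forall hio).mp (hlmi hio) ξ
  have e1 : ∑ j ∈ ν.N i, ν.w i j * quad (ν.P j) (ξ j)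
      = ∑ j ∈ o.N i, o.w i j * quad (o.P j) (ξ j) := by
    rw [← hN]
    exact Finset.sum_congr rfl fun j hj => by rw [hw j hj, hPj j hj]
  have e2 : ∑ k : Fin p, ∑ j ∈ (ν.N i).erase i,
        (ν.l i j k * (ν.C j k ⬝ᵥ ξ j - ν.C i k ⬝ᵥ ξ i)) • ν.F i k
      = ∑ k : Fin p, ∑ j ∈ (o.N i).erase i,
        (o.l i j k * (o.C j k ⬝ᵥ ξ j - o.C i k ⬝ᵥ ξ i)) • o.F i k := by
    rw [← hN]
    refine Finset.sum_congr rfl fun k _ => Finset.sum_congr rfl fun j hj => ?_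
    have hj := Finset.mem_of_mem_erase hj
    rw [hl j hj, hCj j hj, hC, hF]
  rw [e1, e2, hA, hB, hK, hP, hQ, hR]
  exact h1

/-- The local matrix inequalities hold in all networks that arise through requests. -/
lemma localLMI_of_requests {k : ℕ} {net : ℕ → Network ι n m q r p}
    (hinit : ∀ i ∈ (net 0).M, (net 0).LocalLMI i)
    (hreq : ∀ s < k, PnPRequest (net s) (net (s + 1)))
    (hlmi : ∀ s < k, ∀ i ∈ redesignSet (net s) (net (s + 1)), (net (s + 1)).LocalLMI i) :
    ∀ i ∈ (net k).M, (net k).LocalLMI i := by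
  induction k with
  | zero => exact hinit
  | succ k ih =>
    have ih := ih (fun s hs => hreq s (by omega)) (fun s hs => hlmi s (by omega))
    intro i hi
    by_cases hr : i ∈ redesignSet (net k) (net (k + 1))
    · exact hlmi k (by omega) i hr
    · exact (hreq k (by omega)).localLMI hi hr (ih i)

end Requests

end Network

/-! ### Membership in an ellipsoid from diagonal dominance -/

section Ellipsoid

variable {a b : Type*} [Fintype a] [Fintype b]

/-- The cost of one off-diagonal entry `z` in a dominance argument: it is charged equally to the two
diagonal positions that it couples. -/
lemma neg_mul_add_le_two_mul_mul {M : ℝ} (hM : 0 ≤ M) (v w z : ℝ) (hz : |z| ≤ M) :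
    -(M * (v ^ 2 + w ^ 2)) ≤ 2 * (v * (z * w)) := by
  have h1 : |2 * (v * (z * w))| ≤ M * (v ^ 2 + w ^ 2) := by
    have e : |2 * (v * (z * w))| = |z| * (2 * (|v| * |w|)) := by
      simp only [abs_mul, abs_two]; ring
    rw [e]
    have h2 : 2 * (|v| * |w|) ≤ v ^ 2 + w ^ 2 := by
      nlinarith [sq_nonneg (|v| - |w|), sq_abs v, sq_abs w]
    exact mul_le_mul hz h2 (by positivity) hM
  exact (abs_le.mp h1).1

/-- If a slack vector `s` is bounded by `b` and `b` is dominated by the diagonal of `α P⁻¹`, then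
`s` lies in the ellipsoid of radius `α`. -/
lemma quad_le_sq_of_dominated [DecidableEq a] {P : Matrix a a ℝ} (hP : P.PosDef) {α : ℝ}
    (hα : 0 ≤ α) {bb y : a → ℝ} (h1 : ∀ j, bb j + α * rowAbs P⁻¹ j ≤ 2 * α * P⁻¹ j j)
    (h2 : ∑ j, bb j ≤ α) (hy : ∀ j, |y j| ≤ bb j) : quad P y ≤ α ^ 2 := by
  refine quad_le_sq_of_forall hP hα fun v => ?_
  have hd := mul_le_mul_of_nonneg_left (sum_dominance_le_quad hP.inv.isHermitian v) hα
  -- The second variable is the constant `1`, the last coordinate of the Schur complement matrix.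
  -- Half of the slack is charged to the block `α P⁻¹`, the other half to the scalar `α`.
  have hvy : -∑ k, bb k * (v k ^ 2 + 1) ≤ 2 * (v ⬝ᵥ y) := by
    rw [dotProduct, Finset.mul_sum, ← Finset.sum_neg_distrib]
    refine Finset.sum_le_sum fun k _ => ?_
    have := neg_mul_add_le_two_mul_mul ((abs_nonneg _).trans (hy k)) (v k) 1 (y k) (hy k)
    simpa using this
  have hb : ∑ k, bb k * v k ^ 2 ≤ α * ∑ k, (2 * P⁻¹ k k - rowAbs P⁻¹ k) * v k ^ 2 := by
    rw [Finset.mul_sum]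
    refine Finset.sum_le_sum fun k _ => ?_
    nlinarith [h1 k, sq_nonneg (v k)]
  have e : ∑ k, bb k * (v k ^ 2 + 1) = ∑ k, bb k * v k ^ 2 + ∑ k, bb k := by
    rw [← Finset.sum_add_distrib]; exact Finset.sum_congr rfl fun k _ => by ring
  linarith

/-- The S-procedure with diagonal dominance: if `w` satisfies `wᵀ Z w ≤ σ`, then `Y w + s` lies in
the ellipsoid of radius `α`. -/
lemma quad_le_sq_of_sProcedure [DecidableEq a] {P : Matrix a a ℝ} (hP : P.PosDef) {α σ : ℝ}
    (hα : 0 ≤ α) {Y : Matrix a b ℝ} {s bb : a → ℝ} {w : b → ℝ}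
    (h1 : ∀ k, α * rowAbs P⁻¹ k + ∑ l, |Y k l| + bb k ≤ 2 * α * P⁻¹ k k)
    (hs : ∀ k, |s k| ≤ bb k) (h2 : ∑ l, (∑ k, |Y k l|) * w l ^ 2 ≤ σ)
    (h3 : ∑ k, bb k ≤ α - σ) : quad P (Y *ᵥ w + s) ≤ α ^ 2 := by
  refine quad_le_sq_of_forall hP hα fun v => ?_
  have hd := mul_le_mul_of_nonneg_left (sum_dominance_le_quad hP.inv.isHermitian v) hα
  have hvs : -∑ k, bb k * (v k ^ 2 + 1) ≤ 2 * (v ⬝ᵥ s) := by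
    rw [dotProduct, Finset.mul_sum, ← Finset.sum_neg_distrib]
    refine Finset.sum_le_sum fun k _ => ?_
    have := neg_mul_add_le_two_mul_mul ((abs_nonneg _).trans (hs k)) (v k) 1 (s k) (hs k)
    simpa using this
  -- Row sums of `|Y|` are charged to `α P⁻¹`, column sums to the `w` block. The latter consume at
  -- most `σ` of the scalar `α`; the rest pays for the slack.
  have hvY : -∑ k, ∑ l, |Y k l| * (v k ^ 2 + w l ^ 2) ≤ 2 * (v ⬝ᵥ (Y *ᵥ w)) := by
    simp only [dotProduct, Matrix.mulVec, Finset.mul_sum, ← Finset.sum_neg_distrib]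
    exact Finset.sum_le_sum fun k _ => Finset.sum_le_sum fun l _ =>
      neg_mul_add_le_two_mul_mul (abs_nonneg _) (v k) (w l) (Y k l) le_rfl
  have e1 : ∑ k, ∑ l, |Y k l| * (v k ^ 2 + w l ^ 2)
      = ∑ k, (∑ l, |Y k l|) * v k ^ 2 + ∑ l, (∑ k, |Y k l|) * w l ^ 2 := by
    simp only [mul_add, Finset.sum_add_distrib, Finset.sum_mul]
    congr 1
    exact Finset.sum_comm
  have e : ∑ k, bb k * (v k ^ 2 + 1) = ∑ k, bb k * v k ^ 2 + ∑ k, bb k := by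
    rw [← Finset.sum_add_distrib]; exact Finset.sum_congr rfl fun k _ => by ring
  have hb : ∑ k, (∑ l, |Y k l|) * v k ^ 2 + ∑ k, bb k * v k ^ 2
      ≤ α * ∑ k, (2 * P⁻¹ k k - rowAbs P⁻¹ k) * v k ^ 2 := by
    rw [Finset.mul_sum, ← Finset.sum_add_distrib]
    refine Finset.sum_le_sum fun k _ => ?_
    nlinarith [h1 k, sq_nonneg (v k)]
  rw [dotProduct_add]
  linarith

end Ellipsoid

/-! ### Invariance of the terminal sets and the total terminal cost -/

namespace Network

variable {ι : Type*} [DecidableEq ι] {n m q r : ι → ℕ} {p : ℕ} (ν : Network ι n m q r p)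

lemma dominated_subset_ellipsoid {d : ℕ} {P : Matrix (Fin d) (Fin d) ℝ} (hP : P.PosDef)
    (c : Fin d → ℝ) {α : ℝ} (hα : 0 ≤ α) : dominated d P c α ⊆ ellipsoid d P c α := by
  rintro x ⟨bb, h1, h2, h3⟩
  exact quad_le_sq_of_dominated hP hα h1 h2 fun j => abs_le.mpr (h3 j)

/-- The terminal set of subsystem `i` is invariant when all neighbours are in their terminal
sets. -/
lemma InvarianceConstraint.quad_le {ν : Network ι n m q r p} {i : ι} (hi : i ∈ ν.M) {α : ι → ℝ}
    {c : ν.StateIdx → ℝ} {d : ν.InputIdx → ℝ} {b : ν.StateIdx → ℝ} {mu : ι → ι → ℝ}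
    (h : ν.InvarianceConstraint i α c d b mu) (hα : ∀ j ∈ ν.N i, 0 ≤ α j) {e : ν.StateIdx → ℝ}
    (he : ∀ j ∈ ν.N i, quad (ν.P j) (ν.U j *ᵥ e) ≤ α j ^ 2) :
    quad (ν.P i) (ν.Acl i *ᵥ (ν.W i *ᵥ e)
      + (ν.Acl i *ᵥ (ν.W i *ᵥ c) + ν.B i *ᵥ (ν.V i *ᵥ d) - ν.U i *ᵥ c)) ≤ α i ^ 2 := by
  obtain ⟨h1, h2, h3, h4, h5⟩ := h
  have hii := ν.self_mem_N i hi
  -- Each neighbour's deviation is scaled by its own radius, so that its `P_j` form is at most `1`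
  -- and the radii move into the matrix `Acl i * αN i α`. The S-procedure with the multipliers `mu i
  -- j` then has `σ = ∑ j, mu i j`.
  set w : ν.NbrIdx i → ℝ := fun s => (α s.1)⁻¹ * (ν.W i *ᵥ e) s with hw
  have hsel : ∀ j ∈ ν.N i, ν.sel i j *ᵥ w = (α j)⁻¹ • (ν.U j *ᵥ e) := fun j hj => by
    rw [← ν.sel_mulVec_W hi hj, ν.sel_mulVec hi hj, ν.sel_mulVec hi hj]
    rfl
  have hmul : ν.αN i α *ᵥ w = ν.W i *ᵥ e := by
    funext s
    rw [αN, Matrix.mulVec_diagonal, hw]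
    -- A terminal set of size zero is a point: the deviation vanishes there, so `0⁻¹ = 0` does no
    -- harm.
    by_cases h0 : α s.1 = 0
    · have := he s.1 s.1.2
      rw [h0, zero_pow two_ne_zero] at this
      have h00 := eq_zero_of_quad_nonpos (ν.P_posDef s.1 (ν.N_subset i hi s.1.2)) this
      rw [← ν.sel_mulVec_W hi s.1.2, ν.sel_mulVec hi s.1.2] at h00
      have := congrFun h00 s.2
      simp only [h0, zero_mul]
      exact this.symm
    · simp only []
      rw [mul_inv_cancel_left₀ h0]
  have hY : ∀ k l, |(ν.Acl i * ν.αN i α) k l| = ((ν.Acl i).map abs * ν.αN i α) k l := fun k l => by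
    simp only [αN, Matrix.mul_diagonal, Matrix.map_apply, abs_mul, abs_of_nonneg (hα l.1 l.1.2)]
  rw [← hmul, Matrix.mulVec_mulVec]
  refine quad_le_sq_of_sProcedure (σ := ∑ j ∈ ν.N i, mu i j) (ν.P_posDef i hi) (hα i hii)
    (bb := ν.U i *ᵥ b) (fun k => ?_) h2 ?_ h4
  · simp only [hY]
    exact h1 k
  · simp only [hY]
    calc ∑ l, (∑ k, ((ν.Acl i).map abs * ν.αN i α) k l) * w l ^ 2
        ≤ ∑ l, (∑ j ∈ ν.N i, mu i j * (2 * ν.Pij i j l l - rowAbs (ν.Pij i j) l)) * w l ^ 2 := by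
          refine Finset.sum_le_sum fun l _ => mul_le_mul_of_nonneg_right ?_ (sq_nonneg _)
          have := h3 l
          simp only [Matrix.transpose_apply] at this
          rw [Finset.mul_sum] at this
          have e : ∑ j ∈ ν.N i, mu i j * (2 * ν.Pij i j l l - rowAbs (ν.Pij i j) l)
              = ∑ j ∈ ν.N i, 2 * (mu i j * ν.Pij i j l l)
                - ∑ j ∈ ν.N i, mu i j * rowAbs (ν.Pij i j) l := by
            rw [← Finset.sum_sub_distrib]
            exact Finset.sum_congr rfl fun j _ => by ring
          linarith
      _ = ∑ j ∈ ν.N i, mu i j *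
            ∑ l, (2 * ν.Pij i j l l - rowAbs (ν.Pij i j) l) * w l ^ 2 := by
          simp only [Finset.sum_mul, Finset.mul_sum]
          rw [Finset.sum_comm]
          exact Finset.sum_congr rfl fun j _ => Finset.sum_congr rfl fun l _ => by ring
      _ ≤ ∑ j ∈ ν.N i, mu i j * 1 := by
          refine Finset.sum_le_sum fun j hj => mul_le_mul_of_nonneg_left ?_ (h5 j hj)
          refine (sum_dominance_le_quad (ν.Pij_isHermitian (ν.N_subset i hi hj)) w).trans ?_
          rw [quad_Pij, hsel j hj, quad_smul]
          rcases (hα j hj).eq_or_lt with h0 | h0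
          · simp [← h0]
          · rw [inv_pow, inv_mul_le_iff₀ (by positivity), mul_one]
            exact he j hj
      _ = ∑ j ∈ ν.N i, mu i j := by simp

/-! ### Stacked quantities -/

/-- The sum of the local quadratic forms of the stacked state. -/
def total (X : ∀ i, Matrix (Fin (n i)) (Fin (n i)) ℝ) (x : ν.StateIdx → ℝ) : ℝ :=
  ∑ i ∈ ν.M, quad (X i) (ν.U i *ᵥ x)

/-- The sum of the local quadratic forms of the stacked input. -/
def totalInput (X : ∀ i, Matrix (Fin (m i)) (Fin (m i)) ℝ) (u : ν.InputIdx → ℝ) : ℝ :=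
  ∑ i ∈ ν.M, quad (X i) (ν.V i *ᵥ u)

/-- The successor of the stacked state `x` under the stacked input `u`. -/
def step (x : ν.StateIdx → ℝ) (u : ν.InputIdx → ℝ) : ν.StateIdx → ℝ := fun s =>
  (ν.AN s.1 *ᵥ (ν.W s.1 *ᵥ x) + ν.B s.1 *ᵥ (ν.V s.1 *ᵥ u)) s.2

/-- The stacked terminal feedback without offset. -/
def gain (x : ν.StateIdx → ℝ) : ν.InputIdx → ℝ := fun s => (ν.K s.1 *ᵥ (ν.U s.1 *ᵥ x)) s.2

/-- The stacked terminal closed loop without offset. -/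
def clStep (e : ν.StateIdx → ℝ) : ν.StateIdx → ℝ := fun s => (ν.Acl s.1 *ᵥ (ν.W s.1 *ᵥ e)) s.2

variable {ν}

lemma U_step {i : ι} (hi : i ∈ ν.M) (x : ν.StateIdx → ℝ) (u : ν.InputIdx → ℝ) :
    ν.U i *ᵥ ν.step x u = ν.AN i *ᵥ (ν.W i *ᵥ x) + ν.B i *ᵥ (ν.V i *ᵥ u) := by
  rw [ν.U_mulVec hi]; rfl

lemma V_gain {i : ι} (hi : i ∈ ν.M) (x : ν.StateIdx → ℝ) :
    ν.V i *ᵥ ν.gain x = ν.K i *ᵥ (ν.U i *ᵥ x) := by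
  rw [ν.V_mulVec hi]; rfl

lemma U_clStep {i : ι} (hi : i ∈ ν.M) (e : ν.StateIdx → ℝ) :
    ν.U i *ᵥ ν.clStep e = ν.Acl i *ᵥ (ν.W i *ᵥ e) := by
  rw [ν.U_mulVec hi]; rfl

lemma next_iff {x y : ν.StateIdx → ℝ} {u : ν.InputIdx → ℝ} : ν.Next x u y ↔ y = ν.step x u := by
  refine ⟨fun h => ν.ext_U fun i hi => ?_, ?_⟩
  · rw [h i hi, U_step hi]
  · rintro rfl i hi
    exact U_step hi x u

lemma step_add (x y : ν.StateIdx → ℝ) (u v : ν.InputIdx → ℝ) :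
    ν.step (x + y) (u + v) = ν.step x u + ν.step y v := by
  refine ν.ext_U fun i hi => ?_
  rw [Matrix.mulVec_add, U_step hi, U_step hi, U_step hi]
  simp only [Matrix.mulVec_add]
  abel

lemma step_smul (t : ℝ) (x : ν.StateIdx → ℝ) (u : ν.InputIdx → ℝ) :
    ν.step (t • x) (t • u) = t • ν.step x u := by
  refine ν.ext_U fun i hi => ?_
  rw [Matrix.mulVec_smul, U_step hi, U_step hi]
  simp only [Matrix.mulVec_smul, smul_add]

lemma Acl_mulVec_W {i : ι} (hi : i ∈ ν.M) (x : ν.StateIdx → ℝ) :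
    ν.Acl i *ᵥ (ν.W i *ᵥ x) = ν.AN i *ᵥ (ν.W i *ᵥ x) + ν.B i *ᵥ (ν.K i *ᵥ (ν.U i *ᵥ x)) := by
  rw [Acl_mulVec, ν.sel_mulVec_W hi (ν.self_mem_N i hi)]

lemma step_gain (e : ν.StateIdx → ℝ) : ν.step e (ν.gain e) = ν.clStep e := by
  refine ν.ext_U fun i hi => ?_
  rw [U_step hi, U_clStep hi, Acl_mulVec_W hi, V_gain hi]

lemma step_add_gain (x e : ν.StateIdx → ℝ) (u : ν.InputIdx → ℝ) :
    ν.step (x + e) (u + ν.gain e) = ν.step x u + ν.clStep e := by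
  rw [step_add, step_gain]

lemma gain_add (x y : ν.StateIdx → ℝ) : ν.gain (x + y) = ν.gain x + ν.gain y := by
  refine ν.ext_V fun i hi => ?_
  rw [Matrix.mulVec_add, V_gain hi, V_gain hi, V_gain hi, Matrix.mulVec_add, Matrix.mulVec_add]

lemma total_nonneg {X : ∀ i, Matrix (Fin (n i)) (Fin (n i)) ℝ} (hX : ∀ i ∈ ν.M, (X i).PosDef)
    (x : ν.StateIdx → ℝ) : 0 ≤ ν.total X x :=
  Finset.sum_nonneg fun i hi => quad_nonneg (hX i hi) _

lemma totalInput_nonneg (u : ν.InputIdx → ℝ) : 0 ≤ ν.totalInput ν.R u :=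
  Finset.sum_nonneg fun i hi => quad_nonneg (ν.R_posDef i hi) _

lemma quad_le_total {X : ∀ i, Matrix (Fin (n i)) (Fin (n i)) ℝ} (hX : ∀ i ∈ ν.M, (X i).PosDef)
    (x : ν.StateIdx → ℝ) {i : ι} (hi : i ∈ ν.M) : quad (X i) (ν.U i *ᵥ x) ≤ ν.total X x :=
  Finset.single_le_sum (f := fun i => quad (X i) (ν.U i *ᵥ x))
    (fun j hj => quad_nonneg (hX j hj) _) hi

@[simp] lemma total_zero (X : ∀ i, Matrix (Fin (n i)) (Fin (n i)) ℝ) : ν.total X 0 = 0 := by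
  simp [total]

lemma total_smul (X : ∀ i, Matrix (Fin (n i)) (Fin (n i)) ℝ) (t : ℝ) (x : ν.StateIdx → ℝ) :
    ν.total X (t • x) = t ^ 2 * ν.total X x := by
  simp only [total, Matrix.mulVec_smul, quad_smul, Finset.mul_sum]

lemma total_add_le {X : ∀ i, Matrix (Fin (n i)) (Fin (n i)) ℝ} (hX : ∀ i ∈ ν.M, (X i).PosDef)
    (x y : ν.StateIdx → ℝ) : ν.total X (x + y) ≤ 2 * ν.total X x + 2 * ν.total X y := by
  simp only [total, Matrix.mulVec_add, Finset.mul_sum, ← Finset.sum_add_distrib]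
  exact Finset.sum_le_sum fun i hi => quad_add_le (hX i hi) _ _

lemma continuous_total (X : ∀ i, Matrix (Fin (n i)) (Fin (n i)) ℝ) : Continuous (ν.total X) :=
  continuous_finsetSum _ fun _ _ =>
    (continuous_quad _).comp (Continuous.matrix_mulVec continuous_const continuous_id)

lemma continuous_totalInput (X : ∀ i, Matrix (Fin (m i)) (Fin (m i)) ℝ) :
    Continuous (ν.totalInput X) :=
  continuous_finsetSum _ fun _ _ =>
    (continuous_quad _).comp (Continuous.matrix_mulVec continuous_const continuous_id)

lemma total_bounds {X : ∀ i, Matrix (Fin (n i)) (Fin (n i)) ℝ} (hX : ∀ i ∈ ν.M, (X i).PosDef) :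
    ∃ c C : ℝ, 0 < c ∧ 0 < C ∧
      ∀ x, c * ‖x‖ ^ 2 ≤ ν.total X x ∧ ν.total X x ≤ C * ‖x‖ ^ 2 := by
  refine exists_quadratic_bounds (continuous_total X) (total_smul X) fun x hx => ?_
  refine lt_of_le_of_ne (total_nonneg hX x) fun h0 => hx (ν.ext_U fun i hi => ?_)
  rw [Matrix.mulVec_zero]
  exact eq_zero_of_quad_nonpos (hX i hi) ((quad_le_total hX x hi).trans h0.symm.le)

/-- Summation of the local matrix inequalities: the total terminal cost is a Lyapunov function of
the terminal closed loop. -/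
lemma total_clStep_le (hlmi : ∀ i ∈ ν.M, ν.LocalLMI i) (e : ν.StateIdx → ℝ) :
    ν.total ν.P (ν.clStep e) + ν.total ν.Q e + ν.totalInput ν.R (ν.gain e) ≤ ν.total ν.P e := by
  have h1 : ∀ i ∈ ν.M, quad (ν.P i) (ν.U i *ᵥ ν.clStep e) + quad (ν.Q i) (ν.U i *ᵥ e)
      + quad (ν.R i) (ν.V i *ᵥ ν.gain e)
      ≤ ∑ j ∈ ν.M, ν.w i j * quad (ν.P j) (ν.U j *ᵥ e) := fun i hi => by
    have h2 := (ν.localLMI_iff hi).mp (hlmi i hi) (ν.W i *ᵥ e)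
    rw [ν.sel_mulVec_W hi (ν.self_mem_N i hi)] at h2
    rw [U_clStep hi, V_gain hi]
    have h3 : ∑ j ∈ ν.N i, ν.w i j * quad (ν.P j) (ν.sel i j *ᵥ (ν.W i *ᵥ e))
        = ∑ j ∈ ν.M, ν.w i j * quad (ν.P j) (ν.U j *ᵥ e) := by
      have h4 : ∀ j ∈ ν.N i, ν.w i j * quad (ν.P j) (ν.sel i j *ᵥ (ν.W i *ᵥ e))
          = ν.w i j * quad (ν.P j) (ν.U j *ᵥ e) := fun j hj => by rw [ν.sel_mulVec_W hi hj]
      rw [Finset.sum_congr rfl h4]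
      refine Finset.sum_subset (ν.N_subset i hi) fun j hj hjN => ?_
      -- The weights vanish outside the neighbourhood, which allows all local inequalities to be
      -- summed over the same index set and the order of summation to be exchanged.
      rw [ν.w_zero i hi j hj fun hij => hjN (ν.N_symm j hj i hi hij), zero_mul]
    linarith
  have h5 := Finset.sum_le_sum h1
  rw [Finset.sum_comm] at h5
  have h6 : ∑ j ∈ ν.M, ∑ i ∈ ν.M, ν.w i j * quad (ν.P j) (ν.U j *ᵥ e) ≤ ν.total ν.P e := by
    refine Finset.sum_le_sum fun j hj => ?_
    rw [← Finset.sum_mul]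
    exact mul_le_of_le_one_left (quad_nonneg (ν.P_posDef j hj) _) (ν.w_sum j hj)
  simp only [Finset.sum_add_distrib] at h5
  simp only [total, totalInput] at *
  linarith

lemma total_clStep_le_total (hlmi : ∀ i ∈ ν.M, ν.LocalLMI i) (e : ν.StateIdx → ℝ) :
    ν.total ν.P (ν.clStep e) ≤ ν.total ν.P e := by
  have := total_clStep_le hlmi e
  linarith [total_nonneg ν.Q_posDef e, totalInput_nonneg (ν.gain e)]

end Network

/-! ### Polytopes with the origin in the interior -/

section Polytope

variable {a b : Type*} [Fintype b]

lemma mem_smul_polytope {G : Matrix a b ℝ} {g : a → ℝ} {t : ℝ} (ht : 0 < t) {x : b → ℝ} :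
    x ∈ t • {y | G *ᵥ y ≤ g} ↔ ∀ k, G k ⬝ᵥ x ≤ t * g k := by
  rw [Set.mem_smul_set_iff_inv_smul_mem₀ ht.ne']
  refine forall_congr' fun k => ?_
  rw [Matrix.mulVec_smul, Pi.smul_apply, smul_eq_mul, inv_mul_le_iff₀ ht]
  rfl

/-- A small positive multiple of the row `G k` still lies in the polytope, and pairing it with `G k`
gives a positive lower bound of `g k`. A zero row yields no such strictness and stays a separate
case. -/
lemma polytope_rhs {G : Matrix a b ℝ} {g : a → ℝ}
    (h : (0 : b → ℝ) ∈ interior {y | G *ᵥ y ≤ g}) (k : a) : 0 ≤ g k ∧ (G k = 0 ∨ 0 < g k) := by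
  have h0 : 0 ≤ g k := by simpa using interior_subset h k
  refine ⟨h0, or_iff_not_imp_left.mpr fun hG => ?_⟩
  have hlim : Tendsto (fun t : ℝ => t • G k) (𝓝[>] 0) (𝓝 0) := by
    have : Tendsto (fun t : ℝ => t • G k) (𝓝 0) (𝓝 ((0 : ℝ) • G k)) :=
      (continuous_id.smul continuous_const).tendsto 0
    rw [zero_smul] at this
    exact this.mono_left nhdsWithin_le_nhds
  obtain ⟨t, ht, hpos⟩ :=
    ((hlim.eventually (mem_interior_iff_mem_nhds.mp h)).and self_mem_nhdsWithin).exists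
  have h1 : G k ⬝ᵥ (t • G k) ≤ g k := ht k
  have h2 : 0 < G k ⬝ᵥ G k := by
    refine lt_of_le_of_ne (Finset.sum_nonneg fun i _ => mul_self_nonneg _) fun h3 => hG ?_
    exact dotProduct_self_eq_zero.mp h3.symm
  rw [dotProduct_smul, smul_eq_mul] at h1
  exact lt_of_lt_of_le (mul_pos hpos h2) h1

end Polytope

/-- Small constants are chosen below by intersecting finitely many eventual conditions of this form
with positivity. -/
lemma eventually_mul_le (s : ℝ) {c : ℝ} (hc : 0 < c) : ∀ᶠ t : ℝ in 𝓝[>] 0, s * t ≤ c := by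
  have : Tendsto (fun t : ℝ => s * t) (𝓝 0) (𝓝 (s * 0)) :=
    (continuous_const.mul continuous_id).tendsto 0
  rw [mul_zero] at this
  exact (((tendsto_order.mp this).2 c hc).filter_mono nhdsWithin_le_nhds).mono fun _ h => h.le

/-! ### Terminal sets of uniform size at admissible equilibria -/

namespace Network

variable {ι : Type*} [DecidableEq ι] {n m q r : ι → ℕ} {p : ℕ} {ν : Network ι n m q r p}

/-- The constraints on the parameters of the terminal sets. -/
structure TerminalParams (ν : Network ι n m q r p) (α : ι → ℝ) (c : ν.StateIdx → ℝ)
    (d : ν.InputIdx → ℝ) (b : ν.StateIdx → ℝ) (mu : ι → ι → ℝ) : Prop where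
  size : ∀ i ∈ ν.M, 0 ≤ α i
  invariance : ∀ i ∈ ν.M, ν.InvarianceConstraint i α c d b mu
  term_state : ∀ i ∈ ν.M, ∀ k, ν.G i k ⬝ᵥ (ν.U i *ᵥ c)
      + √(ν.G i k ⬝ᵥ ((ν.P i)⁻¹ *ᵥ ν.G i k)) * α i ≤ ν.g i k
  term_input : ∀ i ∈ ν.M, ∀ l, ν.H i l ⬝ᵥ (ν.K i *ᵥ (ν.U i *ᵥ c)) + ν.H i l ⬝ᵥ (ν.V i *ᵥ d)
      + √((ν.H i l ᵥ* ν.K i) ⬝ᵥ ((ν.P i)⁻¹ *ᵥ (ν.H i l ᵥ* ν.K i))) * α i ≤ ν.h i l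

namespace TerminalParams

variable {α : ι → ℝ} {c : ν.StateIdx → ℝ} {d : ν.InputIdx → ℝ} {b : ν.StateIdx → ℝ}
  {mu : ι → ι → ℝ}

lemma mem_X (h : ν.TerminalParams α c d b mu) {i : ι} (hi : i ∈ ν.M) {x : Fin (n i) → ℝ}
    (hx : quad (ν.P i) (x - ν.U i *ᵥ c) ≤ α i ^ 2) : x ∈ ν.X i := fun k => by
  have h1 := dotProduct_le_of_quad_le (ν.P_posDef i hi) (h.size i hi) hx (ν.G i k)
  rw [dotProduct_sub] at h1
  have h2 := h.term_state i hi k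
  change ν.G i k ⬝ᵥ x ≤ _
  linarith

lemma mem_Uset (h : ν.TerminalParams α c d b mu) {i : ι} (hi : i ∈ ν.M) {x : Fin (n i) → ℝ}
    (hx : quad (ν.P i) (x - ν.U i *ᵥ c) ≤ α i ^ 2) :
    ν.K i *ᵥ x + ν.V i *ᵥ d ∈ ν.Uset i := fun k => by
  have h1 := dotProduct_le_of_quad_le (ν.P_posDef i hi) (h.size i hi) hx (ν.H i k ᵥ* ν.K i)
  rw [← Matrix.dotProduct_mulVec, Matrix.mulVec_sub, dotProduct_sub] at h1
  have h2 := h.term_input i hi k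
  change ν.H i k ⬝ᵥ (ν.K i *ᵥ x + ν.V i *ᵥ d) ≤ _
  rw [dotProduct_add]
  linarith

end TerminalParams

lemma admissibleTarget_iff {xe : ν.StateIdx → ℝ} {ue : ν.InputIdx → ℝ} :
    ν.AdmissibleTarget xe ue ↔ ν.step xe ue = xe ∧ ∀ i ∈ ν.M,
      (∀ k, ν.G i k ⬝ᵥ (ν.U i *ᵥ xe) ≤ ν.lam i * ν.g i k) ∧
      ∀ k, ν.H i k ⬝ᵥ (ν.V i *ᵥ ue) ≤ ν.lam i * ν.h i k := by
  rw [AdmissibleTarget, next_iff, eq_comm]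
  refine and_congr_right fun _ => forall₂_congr fun i hi => ?_
  exact and_congr (mem_smul_polytope (ν.lam_mem i hi).1) (mem_smul_polytope (ν.lam_mem i hi).1)

/-- Admissible equilibria form a convex set. -/
lemma AdmissibleTarget.convex {xe xr : ν.StateIdx → ℝ} {ue ur : ν.InputIdx → ℝ}
    (h₁ : ν.AdmissibleTarget xe ue) (h₂ : ν.AdmissibleTarget xr ur) {t : ℝ} (h0 : 0 ≤ t)
    (h1 : t ≤ 1) :
    ν.AdmissibleTarget ((1 - t) • xe + t • xr) ((1 - t) • ue + t • ur) := by
  rw [admissibleTarget_iff] at *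
  refine ⟨by rw [step_add, step_smul, step_smul, h₁.1, h₂.1], fun i hi => ⟨fun k => ?_, fun k => ?_⟩⟩
  · have a1 := (h₁.2 i hi).1 k
    have a2 := (h₂.2 i hi).1 k
    simp only [Matrix.mulVec_add, Matrix.mulVec_smul, dotProduct_add, dotProduct_smul, smul_eq_mul]
    nlinarith
  · have a1 := (h₁.2 i hi).2 k
    have a2 := (h₂.2 i hi).2 k
    simp only [Matrix.mulVec_add, Matrix.mulVec_smul, dotProduct_add, dotProduct_smul, smul_eq_mul]
    nlinarith

/-- The invariance constraints are homogeneous, and hold with centre at an equilibrium. -/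
lemma InvarianceConstraint.rescale {i : ι} (hi : i ∈ ν.M) {α : ι → ℝ}
    {c : ν.StateIdx → ℝ} {d : ν.InputIdx → ℝ} {b : ν.StateIdx → ℝ} {mu : ι → ι → ℝ}
    (h : ν.InvarianceConstraint i α c d b mu) {t : ℝ} (ht : 0 ≤ t) {xe : ν.StateIdx → ℝ}
    {ue : ν.InputIdx → ℝ} (he : ν.step xe ue = xe) :
    ν.InvarianceConstraint i (fun j => t * α j) xe (ue - ν.gain xe) 0
      (fun j k => t * mu j k) := by
  obtain ⟨h1, h2, h3, h4, h5⟩ := h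
  have hb : ∀ k, 0 ≤ (ν.U i *ᵥ b) k := fun k => (abs_nonneg _).trans (h2 k)
  have hα : ν.αN i (fun j => t * α j) = t • ν.αN i α := by
    rw [αN, αN, ← Matrix.diagonal_smul]; rfl
  rw [InvarianceConstraint, hα, Matrix.mulVec_zero]
  simp only [Matrix.mul_smul, Matrix.smul_apply, Matrix.transpose_smul, smul_eq_mul,
    ← Finset.mul_sum, mul_assoc, Pi.zero_apply]
  refine ⟨fun k => ?_, fun k => ?_, fun k => ?_, ?_, fun j hj => mul_nonneg ht (h5 j hj)⟩
  · have := mul_le_mul_of_nonneg_left (h1 k) ht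
    nlinarith [mul_nonneg ht (hb k)]
  · have e : ν.Acl i *ᵥ ν.W i *ᵥ xe + ν.B i *ᵥ ν.V i *ᵥ (ue - ν.gain xe) - ν.U i *ᵥ xe = 0 := by
      have h6 := U_step hi xe ue
      rw [he] at h6
      rw [Acl_mulVec_W hi, Matrix.mulVec_sub, V_gain hi, Matrix.mulVec_sub, h6]
      abel
    rw [e]
    simp
  · have := mul_le_mul_of_nonneg_left (h3 k) ht
    linarith
  · have h6 := Finset.sum_nonneg fun k (_ : k ∈ Finset.univ) => hb k
    have := mul_le_mul_of_nonneg_left (h6.trans h4) ht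
    simp only [Finset.sum_const_zero]
    linarith

/-- There are terminal sets of a fixed size that may be centred at any admissible equilibrium, and
that contain the terminal closed loop locally, after one step even in the polyhedral version. -/
lemma exists_uniform_terminal
    (hX : ∀ i ∈ ν.M, (0 : Fin (n i) → ℝ) ∈ interior (ν.X i))
    (hU : ∀ i ∈ ν.M, (0 : Fin (m i) → ℝ) ∈ interior (ν.Uset i))
    (hterm : ν.NondegenerateTerminalSets) :
    ∃ δ > 0, ∃ (α : ι → ℝ) (mu : ι → ι → ℝ),
      (∀ xe ue, ν.AdmissibleTarget xe ue → ν.TerminalParams α xe (ue - ν.gain xe) 0 mu) ∧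
      ∀ e, ν.total ν.P e ≤ δ → ∀ i ∈ ν.M, quad (ν.P i) (ν.U i *ᵥ e) ≤ α i ^ 2 ∧
        ∀ c, ν.U i *ᵥ (c + ν.clStep e) ∈ dominated _ (ν.P i) (ν.U i *ᵥ c) (α i) := by
  obtain ⟨α₀, c₀, d₀, b₀, mu₀, h₀⟩ := hterm
  -- An admissible equilibrium satisfies the constraints with right-hand sides `λ_i g` and `λ_i h`.
  -- The ellipsoids are shrunk by `t` until they fit into the remaining margin `1 - λ_i`, which is
  -- the same for all equilibria.
  have ht : ∀ᶠ t : ℝ in 𝓝[>] 0, ∀ i ∈ ν.M,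
      (∀ k, √(ν.G i k ⬝ᵥ ((ν.P i)⁻¹ *ᵥ ν.G i k)) * (t * α₀ i) ≤ (1 - ν.lam i) * ν.g i k) ∧
      ∀ l, √((ν.H i l ᵥ* ν.K i) ⬝ᵥ ((ν.P i)⁻¹ *ᵥ (ν.H i l ᵥ* ν.K i))) * (t * α₀ i)
        ≤ (1 - ν.lam i) * ν.h i l := by
    rw [Filter.eventually_all_finset]
    intro i hi
    have hl : 0 < 1 - ν.lam i := by linarith [(ν.lam_mem i hi).2]
    refine Filter.Eventually.and ?_ ?_
    · rw [Filter.eventually_all]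
      intro k
      obtain ⟨hg, h | h⟩ := polytope_rhs (hX i hi) k
      · refine Eventually.of_forall fun t => ?_
        rw [h]
        simpa using mul_nonneg hl.le hg
      · refine (eventually_mul_le (√(ν.G i k ⬝ᵥ ((ν.P i)⁻¹ *ᵥ ν.G i k)) * α₀ i)
          (mul_pos hl h)).mono fun t ht => ?_
        linarith
    · rw [Filter.eventually_all]
      intro k
      obtain ⟨hg, h | h⟩ := polytope_rhs (hU i hi) k
      · refine Eventually.of_forall fun t => ?_
        rw [h]
        simpa using mul_nonneg hl.le hg
      · refine (eventually_mul_le (√((ν.H i k ᵥ* ν.K i) ⬝ᵥ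
          ((ν.P i)⁻¹ *ᵥ (ν.H i k ᵥ* ν.K i))) * α₀ i) (mul_pos hl h)).mono fun t ht => ?_
        linarith
  obtain ⟨t, ht, htpos⟩ := (ht.and self_mem_nhdsWithin).exists
  have htpos : 0 < t := htpos
  have hα : ∀ i ∈ ν.M, 0 < t * α₀ i := fun i hi => mul_pos htpos (h₀ i hi).1
  have hparams : ∀ xe ue, ν.AdmissibleTarget xe ue →
      ν.TerminalParams (fun j => t * α₀ j) xe (ue - ν.gain xe) 0 (fun j k => t * mu₀ j k) := by
    intro xe ue had
    rw [admissibleTarget_iff] at had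
    refine ⟨fun i hi => (hα i hi).le, fun i hi => (h₀ i hi).2.rescale hi htpos.le had.1,
      fun i hi k => ?_, fun i hi k => ?_⟩
    · linarith [(ht i hi).1 k, (had.2 i hi).1 k]
    · rw [Matrix.mulVec_sub, V_gain hi, dotProduct_sub]
      linarith [(ht i hi).2 k, (had.2 i hi).2 k]
  obtain ⟨cP, _, hcP, _, hPb⟩ := total_bounds ν.P_posDef
  -- `η` is a sup-norm radius. The three bounds serve, in order, the dominance condition of the
  -- polyhedral set, its bound on the sum of the slacks, and the ellipsoid, whose squared radius
  -- must exceed `δ = cP * η ^ 2`.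
  have hη : ∀ᶠ η : ℝ in 𝓝[>] 0, ∀ i ∈ ν.M, 1 * η ≤ t * α₀ i ∧
      (∑ k, ∑ l, |ν.Acl i k l|) * η ≤ t * α₀ i ∧ √cP * η ≤ t * α₀ i := by
    rw [Filter.eventually_all_finset]
    exact fun i hi => (eventually_mul_le _ (hα i hi)).and
      ((eventually_mul_le _ (hα i hi)).and (eventually_mul_le _ (hα i hi)))
  obtain ⟨η, hη, hηpos⟩ := (hη.and self_mem_nhdsWithin).exists
  have hηpos : 0 < η := hηpos
  refine ⟨cP * η ^ 2, by positivity, fun j => t * α₀ j, fun j k => t * mu₀ j k, hparams,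
    fun e he i hi => ?_⟩
  obtain ⟨h1, h2, h3⟩ := hη i hi
  have hen : ‖e‖ ≤ η := by
    have := (hPb e).1.trans he
    exact (pow_le_pow_iff_left₀ (norm_nonneg e) hηpos.le two_ne_zero).mp
      (le_of_mul_le_mul_left this hcP)
  refine ⟨(quad_le_total ν.P_posDef e hi).trans (he.trans ?_), fun c => ?_⟩
  · have h4 : (√cP * η) ^ 2 ≤ (t * α₀ i) ^ 2 := pow_le_pow_left₀ (by positivity) h3 2
    rwa [mul_pow, Real.sq_sqrt hcP.le] at h4
  · have hab : ∀ k, |(ν.Acl i *ᵥ (ν.W i *ᵥ e)) k| ≤ ∑ l, |ν.Acl i k l| * η := fun k => by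
      refine (Finset.abs_sum_le_sum_abs _ _).trans (Finset.sum_le_sum fun l _ => ?_)
      rw [abs_mul]
      refine mul_le_mul_of_nonneg_left ?_ (abs_nonneg _)
      rw [ν.W_mulVec hi]
      exact (norm_le_pi_norm e _).trans hen
    refine ⟨fun k => ∑ l, |ν.Acl i k l| * η, fun k => ?_, ?_, fun k => ?_⟩
    · have h5 := (h₀ i hi).2.1 k
      have hb := (abs_nonneg _).trans ((h₀ i hi).2.2.1 k)
      -- The invariance constraint already reserves room for the term `|Acl| α_N`. This room is what
      -- the slack of the successor uses; the state before the step has no such reserve, hence the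
      -- single step in the statement.
      have h6 : ∑ l, |ν.Acl i k l| * η ≤ t * ∑ l, ((ν.Acl i).map abs * ν.αN i α₀) k l := by
        rw [Finset.mul_sum]
        refine Finset.sum_le_sum fun l _ => ?_
        rw [αN, Matrix.mul_diagonal, Matrix.map_apply]
        have h7 := (hη l.1 (ν.N_subset i hi l.1.2)).1
        have := mul_le_mul_of_nonneg_left h7 (abs_nonneg (ν.Acl i k l))
        linarith
      have h8 := mul_le_mul_of_nonneg_left h5 htpos.le
      nlinarith [mul_nonneg htpos.le hb]
    · simpa only [Finset.sum_mul] using h2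
    · have := abs_le.mp (hab k)
      rw [Matrix.mulVec_add, U_clStep hi]
      simpa using this

/-! ### Plans -/

/-- The stage cost of the stacked deviations. -/
def stage (ν : Network ι n m q r p) (x : ν.StateIdx → ℝ) (u : ν.InputIdx → ℝ) : ℝ :=
  ν.total ν.Q x + ν.totalInput ν.R u

lemma total_le_stage (x : ν.StateIdx → ℝ) (u : ν.InputIdx → ℝ) : ν.total ν.Q x ≤ ν.stage x u :=
  le_add_of_nonneg_right (totalInput_nonneg u)

lemma stage_nonneg (x : ν.StateIdx → ℝ) (u : ν.InputIdx → ℝ) : 0 ≤ ν.stage x u :=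
  (total_nonneg ν.Q_posDef x).trans (total_le_stage x u)

lemma cost_eq (T : ℕ) (xr : ν.StateIdx → ℝ) (z : ν.Plan) :
    ν.cost T xr z = ∑ t ∈ Finset.range T, ν.stage (z.x t - z.xe) (z.u t - z.ue)
      + ν.total ν.P (z.x T - z.xe) + ν.total ν.S (z.xe - xr) := by
  simp only [cost, stage, total, totalInput, Matrix.mulVec_sub, Finset.sum_add_distrib]
  congr 3
  · exact Finset.sum_comm
  · exact Finset.sum_comm

lemma total_P_le_cost (T : ℕ) (xr : ν.StateIdx → ℝ) (z : ν.Plan) :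
    ν.total ν.P (z.x T - z.xe) ≤ ν.cost T xr z := by
  rw [cost_eq]
  have := Finset.sum_nonneg fun t (_ : t ∈ Finset.range T) =>
    stage_nonneg (z.x t - z.xe) (z.u t - z.ue)
  linarith [total_nonneg ν.S_posDef (z.xe - xr)]

lemma total_Q_le_cost {T : ℕ} (hT : 1 ≤ T) (xr : ν.StateIdx → ℝ) (z : ν.Plan) :
    ν.total ν.Q (z.x 0 - z.xe) + ν.total ν.S (z.xe - xr) ≤ ν.cost T xr z := by
  rw [cost_eq]
  have := Finset.single_le_sum (f := fun t => ν.stage (z.x t - z.xe) (z.u t - z.ue))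
    (fun t _ => stage_nonneg _ _) (Finset.mem_range.mpr hT)
  have h2 := total_le_stage (z.x 0 - z.xe) (z.u 0 - z.ue)
  linarith [total_nonneg ν.P_posDef (z.x T - z.xe)]

namespace Feasible

variable {Xf : TerminalConstraint} {T : ℕ} {x₀ : ν.StateIdx → ℝ} {z : ν.Plan}

lemma admissible (h : ν.Feasible Xf T x₀ z) : ν.AdmissibleTarget z.xe z.ue :=
  ⟨h.eq_dyn, fun i hi => ⟨h.eq_state i hi, h.eq_input i hi⟩⟩

lemma terminalParams (h : ν.Feasible Xf T x₀ z) : ν.TerminalParams z.α z.c z.d z.b z.mu :=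
  ⟨h.size, h.invariance, h.term_state, h.term_input⟩

lemma ue_eq (h : ν.Feasible Xf T x₀ z) : z.ue = ν.gain z.xe + z.d :=
  ν.ext_V fun i hi => by rw [h.eq_ctrl i hi, Matrix.mulVec_add, V_gain hi]

/-- The successor of the final predicted state under the terminal controller. -/
lemma step_terminal (h : ν.Feasible Xf T x₀ z) (x : ν.StateIdx → ℝ) :
    ν.step x (ν.gain x + z.d) = z.xe + ν.clStep (x - z.xe) := by
  have h1 : ν.gain x + z.d = z.ue + ν.gain (x - z.xe) := by
    have h2 := gain_add z.xe (x - z.xe)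
    rw [add_sub_cancel] at h2
    rw [h.ue_eq, h2]
    abel
  have h3 := step_add_gain z.xe (x - z.xe) z.ue
  rw [← next_iff.mp h.eq_dyn, add_sub_cancel] at h3
  rw [h1, h3]

/-- The plan that is shifted by one step and continued with the terminal controller, possibly with
other terminal sets. -/
lemma shift (h : ν.Feasible Xf T x₀ z) (hlmi : ∀ i ∈ ν.M, ν.LocalLMI i) (hT : 1 ≤ T)
    (xr : ν.StateIdx → ℝ) {α : ι → ℝ} {c b : ν.StateIdx → ℝ} {mu : ι → ι → ℝ}
    (hp : ν.TerminalParams α c z.d b mu)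
    (hnow : ∀ i ∈ ν.M, quad (ν.P i) (ν.U i *ᵥ z.x T - ν.U i *ᵥ c) ≤ α i ^ 2)
    (hnext : ∀ i ∈ ν.M, quad (ν.P i)
      (ν.U i *ᵥ (z.xe + ν.clStep (z.x T - z.xe)) - ν.U i *ᵥ c) ≤ α i ^ 2)
    (hXf : ∀ i ∈ ν.M,
      ν.U i *ᵥ (z.xe + ν.clStep (z.x T - z.xe)) ∈ Xf (n i) (ν.P i) (ν.U i *ᵥ c) (α i)) :
    ∃ z', ν.Feasible Xf T (z.x 1) z' ∧
      ν.cost T xr z' + ν.total ν.Q (x₀ - z.xe) ≤ ν.cost T xr z := by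
  obtain ⟨T, rfl⟩ := Nat.exists_eq_add_of_le' hT
  set xN := z.xe + ν.clStep (z.x (T + 1) - z.xe) with hxN
  refine ⟨⟨fun t => if t < T + 1 then z.x (t + 1) else xN,
    fun t => if t < T then z.u (t + 1) else ν.gain (z.x (T + 1)) + z.d, z.xe, z.ue, α, c, z.d, b,
    mu⟩, ⟨by simp, fun t ht => ?_, fun t ht i hi => ?_, fun t ht i hi => ?_, h.eq_dyn, h.eq_state,
      h.eq_ctrl, h.eq_input, hp.size, fun i hi => by simpa using hXf i hi, hp.invariance,
      hp.term_state, hp.term_input⟩, ?_⟩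
  · simp only [if_pos ht]
    rcases Nat.lt_succ_iff_lt_or_eq.mp ht with h1 | rfl
    · simpa only [if_pos h1, if_pos (Nat.succ_lt_succ h1)] using h.dyn (t + 1) (by omega)
    · simp only [lt_irrefl, if_false]
      rw [next_iff, h.step_terminal]
  · by_cases h1 : t < T + 1
    · simpa only [if_pos h1] using h.state (t + 1) (by omega) i hi
    · simp only [if_neg h1]
      exact hp.mem_X hi (hnext i hi)
  · by_cases h1 : t < T
    · simpa only [if_pos h1] using h.input (t + 1) (by omega) i hi
    · simp only [if_neg h1]
      rw [Matrix.mulVec_add, V_gain hi]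
      exact hp.mem_Uset hi (hnow i hi)
  -- The terminal inequality is applied to the deviation from `xe`, not from the terminal centre
  -- `c`. It pays for the appended stage cost and the new terminal cost.
  · have h1 := total_clStep_le hlmi (z.x (T + 1) - z.xe)
    have h2 : ν.gain (z.x (T + 1)) + z.d - z.ue = ν.gain (z.x (T + 1) - z.xe) := by
      have h2 := gain_add z.xe (z.x (T + 1) - z.xe)
      rw [add_sub_cancel] at h2
      rw [h.ue_eq, h2]
      abel
    have h3 := total_le_stage (z.x 0 - z.xe) (z.u 0 - z.ue)
    have h4 : ∑ t ∈ Finset.range T, ν.stage ((if t < T + 1 then z.x (t + 1) else xN) - z.xe)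
          ((if t < T then z.u (t + 1) else ν.gain (z.x (T + 1)) + z.d) - z.ue)
        = ∑ t ∈ Finset.range T, ν.stage (z.x (t + 1) - z.xe) (z.u (t + 1) - z.ue) := by
      refine Finset.sum_congr rfl fun t ht => ?_
      have ht := Finset.mem_range.mp ht
      rw [if_pos (by omega), if_pos ht]
    rw [cost_eq, cost_eq, Finset.sum_range_succ, Finset.sum_range_succ']
    simp only [h4, lt_irrefl, if_false, lt_add_iff_pos_right, zero_lt_one, if_true]
    rw [h2, stage, hxN, add_sub_cancel_left, ← h.init]
    linarith

end Feasible

lemma Feasible.mono {Xf Xf' : TerminalConstraint} {T : ℕ} {x₀ : ν.StateIdx → ℝ} {z : ν.Plan}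
    (h : ν.Feasible Xf T x₀ z)
    (hsub : ∀ i ∈ ν.M, ∀ c α, 0 ≤ α → Xf (n i) (ν.P i) c α ⊆ Xf' (n i) (ν.P i) c α) :
    ν.Feasible Xf' T x₀ z :=
  { h with terminal := fun i hi => hsub i hi _ _ (h.size i hi) (h.terminal i hi) }

lemma Feasible.to_ellipsoid {T : ℕ} {x₀ : ν.StateIdx → ℝ} {z : ν.Plan}
    (h : ν.Feasible dominated T x₀ z) : ν.Feasible ellipsoid T x₀ z :=
  h.mono fun i hi c _ hα => dominated_subset_ellipsoid (ν.P_posDef i hi) c hα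

/-- The terminal controller with an admissible artificial equilibrium close to the measured
state yields a feasible plan. -/
lemma exists_local_plan (hlmi : ∀ i ∈ ν.M, ν.LocalLMI i) {T : ℕ} (hT : 1 ≤ T) {δ : ℝ}
    {α : ι → ℝ} {mu : ι → ι → ℝ} {xe : ν.StateIdx → ℝ} {ue : ν.InputIdx → ℝ}
    (had : ν.AdmissibleTarget xe ue) (hp : ν.TerminalParams α xe (ue - ν.gain xe) 0 mu)
    (hloc : ∀ e, ν.total ν.P e ≤ δ → ∀ i ∈ ν.M, quad (ν.P i) (ν.U i *ᵥ e) ≤ α i ^ 2 ∧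
        ∀ c, ν.U i *ᵥ (c + ν.clStep e) ∈ dominated _ (ν.P i) (ν.U i *ᵥ c) (α i))
    (xr : ν.StateIdx → ℝ) {x : ν.StateIdx → ℝ} (hx : ν.total ν.P (x - xe) ≤ δ) :
    ∃ z, ν.Feasible dominated T x z ∧
      ν.cost T xr z ≤ ν.total ν.P (x - xe) + ν.total ν.S (xe - xr) := by
  set e : ℕ → ν.StateIdx → ℝ := fun t => ν.clStep^[t] (x - xe) with he
  have hsucc : ∀ t, e (t + 1) = ν.clStep (e t) := fun t => Function.iterate_succ_apply' _ _ _
  have hdec : ∀ t, ν.total ν.P (e t) ≤ δ := fun t => by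
    induction t with
    | zero => exact hx
    | succ t ih => rw [hsucc]; exact (total_clStep_le_total hlmi _).trans ih
  have hell : ∀ t, ∀ i ∈ ν.M,
      quad (ν.P i) (ν.U i *ᵥ (xe + e t) - ν.U i *ᵥ xe) ≤ α i ^ 2 := fun t i hi => by
    rw [Matrix.mulVec_add, add_sub_cancel_left]
    exact (hloc _ (hdec t) i hi).1
  refine ⟨⟨fun t => xe + e t, fun t => ue + ν.gain (e t), xe, ue, α, xe, ue - ν.gain xe, 0, mu⟩,
    ⟨by simp [he], fun t _ => ?_, fun t _ i hi => hp.mem_X hi (hell t i hi), fun t _ i hi => ?_,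
      had.1, fun i hi => (had.2 i hi).1, fun i hi => ?_, fun i hi => (had.2 i hi).2, hp.size,
      fun i hi => ?_, hp.invariance, hp.term_state, hp.term_input⟩, ?_⟩
  · simp only [next_iff, hsucc, step_add_gain, ← next_iff.mp had.1]
  · have h1 := hp.mem_Uset hi (hell t i hi)
    rw [Matrix.mulVec_sub, V_gain hi, Matrix.mulVec_add, Matrix.mulVec_add] at h1
    rw [Matrix.mulVec_add, V_gain hi]
    convert h1 using 1
    abel
  · rw [Matrix.mulVec_sub, V_gain hi, add_sub_cancel]
  -- The polyhedral terminal constraint is only guaranteed after at least one step of the terminal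
  -- closed loop; here `T ≥ 1` enters.
  · obtain ⟨T, rfl⟩ := Nat.exists_eq_add_of_le' hT
    simp only [hsucc]
    exact (hloc _ (hdec T) i hi).2 xe
  · rw [cost_eq]
    simp only [add_sub_cancel_left]
    have h1 : ∀ T, ∑ t ∈ Finset.range T, ν.stage (e t) (ν.gain (e t)) + ν.total ν.P (e T)
        ≤ ν.total ν.P (x - xe) := fun T => by
      induction T with
      | zero => simp [he]
      | succ T ih =>
        rw [Finset.sum_range_succ, hsucc, stage]
        linarith [total_clStep_le hlmi (e T)]
    linarith [h1 T]

/-! ### Asymptotic stability from the decrease of the optimal cost -/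

/-- The decrease telescopes, so the partial sums of `a` are bounded by `v 0`, and the terms of a
convergent series tend to zero. -/
lemma tendsto_zero_of_decrease {v a : ℕ → ℝ} (hv : ∀ t, 0 ≤ v t) (ha : ∀ t, 0 ≤ a t)
    (h : ∀ t, v (t + 1) + a t ≤ v t) : Tendsto a atTop (𝓝 0) := by
  refine (summable_of_sum_range_le (c := v 0) ha fun N => ?_).tendsto_atTop_zero
  have : ∀ N, ∑ t ∈ Finset.range N, a t + v N ≤ v 0 := fun N => by
    induction N with
    | zero => simp
    | succ N ih => rw [Finset.sum_range_succ]; linarith [h N]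
  linarith [this N, hv N]

/-- If the optimal cost decreases along closed-loop trajectories by the first stage cost, and if
every admissible equilibrium can be tracked from a neighbourhood of uniform size, then the closed
loop is asymptotically stable to the target. -/
lemma asymptoticallyStable_of_decrease {Xf : TerminalConstraint} {T : ℕ} (hT : 1 ≤ T)
    {xr : ν.StateIdx → ℝ} {ur : ν.InputIdx → ℝ} (htarget : ν.AdmissibleTarget xr ur)
    {E : Set (ν.StateIdx → ℝ)} (hnhds : E ∈ 𝓝 xr) (hfeas : E ⊆ ν.feasibleStates Xf T)
    (hsolv : (∀ i ∈ ν.M, Bornology.IsBounded (ν.X i) ∧ Bornology.IsBounded (ν.Uset i)) →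
      ∀ x ∈ E, ∃ z, ν.Optimal Xf T xr x z)
    {δ : ℝ} (hδ : 0 < δ)
    (hlocal : ∀ xe ue, ν.AdmissibleTarget xe ue → ∀ x, ν.total ν.P (x - xe) ≤ δ →
      ∃ z, ν.Feasible Xf T x z ∧ ν.cost T xr z ≤ ν.total ν.P (x - xe) + ν.total ν.S (xe - xr))
    (hstep : ∀ x ∈ E, ∀ z, ν.Optimal Xf T xr x z → z.x 1 ∈ E ∧ ∃ z', ν.Feasible Xf T (z.x 1) z' ∧
      ν.cost T xr z' + ν.total ν.Q (x - z.xe) ≤ ν.cost T xr z) :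
    ν.AsymptoticallyStable Xf T xr E := by
  have hsucc : ∀ {x u y z}, ν.Optimal Xf T xr x z → z.u 0 = u → ν.Next x u y → z.x 1 = y := by
    intro x u y z hz hu hy
    have h1 := next_iff.mp (hz.1.dyn 0 hT)
    rw [hz.1.init, hu, zero_add, ← next_iff.mp hy] at h1
    exact h1
  have hinv : ∀ x ∈ E, ∀ u y, ν.MPCStep Xf T xr x u y → y ∈ E := by
    rintro x hx u y ⟨⟨z, hz, hu⟩, hy⟩
    rw [← hsucc hz hu hy]
    exact (hstep x hx z hz).1
  have hstay : ∀ x u, ν.ClosedLoop Xf T xr x u → x 0 ∈ E → ∀ t, x t ∈ E := by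
    intro x u hcl h0 t
    induction t with
    | zero => exact h0
    | succ t ih => exact hinv _ ih _ _ (hcl t)
  obtain ⟨cQ, _, hcQ, _, hQb⟩ := total_bounds ν.Q_posDef
  obtain ⟨cS, _, hcS, _, hSb⟩ := total_bounds ν.S_posDef
  obtain ⟨_, CP, _, hCP, hPb⟩ := total_bounds ν.P_posDef
  have hplans : ∀ x u, ν.ClosedLoop Xf T xr x u → x 0 ∈ E → ∃ z : ℕ → ν.Plan,
      (∀ t, ν.Optimal Xf T xr (x t) (z t)) ∧
      (∀ t, ν.cost T xr (z (t + 1)) + ν.total ν.Q (x t - (z t).xe) ≤ ν.cost T xr (z t)) ∧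
      (∀ t, ν.total ν.Q (x t - (z t).xe) + ν.total ν.S ((z t).xe - xr) ≤ ν.cost T xr (z t)) ∧
      ∀ t, ν.cost T xr (z t) ≤ ν.cost T xr (z 0) := by
    intro x u hcl h0
    choose z hz hu using fun t => (hcl t).1
    have hdec : ∀ t, ν.cost T xr (z (t + 1)) + ν.total ν.Q (x t - (z t).xe)
        ≤ ν.cost T xr (z t) := fun t => by
      obtain ⟨-, z', hz', hc⟩ := hstep _ (hstay x u hcl h0 t) (z t) (hz t)
      rw [hsucc (hz t) (hu t) (hcl t).2] at hz'
      linarith [(hz (t + 1)).2 z' hz']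
    refine ⟨z, hz, hdec, fun t => ?_, fun t => ?_⟩
    · have := total_Q_le_cost hT xr (z t)
      rwa [(hz t).1.init] at this
    · induction t with
      | zero => exact le_rfl
      | succ t ih => linarith [hdec t, total_nonneg ν.Q_posDef (x t - (z t).xe)]
  refine ⟨hnhds, hfeas, hsolv, hinv, ?_, ?_, ?_⟩
  · intro x u hcl _ t i hi
    obtain ⟨⟨z, hz, hu⟩, -⟩ := hcl t
    refine ⟨?_, ?_⟩
    · rw [← hz.1.init]
      exact hz.1.state 0 (Nat.zero_le _) i hi
    · rw [← hu]
      exact hz.1.input 0 hT i hi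
  · intro ε hε
    -- A cost of at most `κ` bounds both `x - xe` and `xe - xr` by `ε / 3`. The additional bound by
    -- `δ` makes the target trackable from the initial state, which gives the upper bound on the
    -- initial cost.
    set κ := min cQ cS * (ε / 3) ^ 2 with hκ
    have hc : 0 < min cQ cS := lt_min hcQ hcS
    have hκpos : 0 < κ := by positivity
    have hmin : 0 < min δ κ := lt_min hδ hκpos
    refine ⟨√(min δ κ / CP), by positivity, fun x u hcl h0 hx t => ?_⟩
    obtain ⟨z, hz, -, hlow, hmono⟩ := hplans x u hcl h0
    have h1 : ν.total ν.P (x 0 - xr) ≤ min δ κ := by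
      refine (hPb _).2.trans ?_
      rw [dist_eq_norm] at hx
      have h2 : ‖x 0 - xr‖ ^ 2 ≤ min δ κ / CP := by
        rw [← Real.sq_sqrt (by positivity : 0 ≤ min δ κ / CP)]
        exact pow_le_pow_left₀ (norm_nonneg _) hx.le 2
      rw [le_div_iff₀ hCP] at h2
      linarith
    obtain ⟨z', hz', hc'⟩ := hlocal xr ur htarget (x 0) (h1.trans (min_le_left _ _))
    rw [sub_self, total_zero, add_zero] at hc'
    have hv : ν.cost T xr (z t) ≤ κ :=
      (hmono t).trans (((hz 0).2 z' hz').trans (hc'.trans (h1.trans (min_le_right _ _))))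
    have hnorm : ∀ {c : ℝ} (y : ν.StateIdx → ℝ), min cQ cS ≤ c → c * ‖y‖ ^ 2 ≤ κ →
        ‖y‖ ≤ ε / 3 := fun {c} y hc1 hy => by
      have h3 : min cQ cS * ‖y‖ ^ 2 ≤ min cQ cS * (ε / 3) ^ 2 :=
        (mul_le_mul_of_nonneg_right hc1 (sq_nonneg _)).trans hy
      exact (pow_le_pow_iff_left₀ (norm_nonneg y) (by positivity) two_ne_zero).mp
        (le_of_mul_le_mul_left h3 hc)
    have hl := hlow t
    have h4 := hnorm (x t - (z t).xe) (min_le_left _ _)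
      ((hQb _).1.trans (by linarith [total_nonneg ν.S_posDef ((z t).xe - xr)]))
    have h5 := hnorm ((z t).xe - xr) (min_le_right _ _)
      ((hSb _).1.trans (by linarith [total_nonneg ν.Q_posDef (x t - (z t).xe)]))
    rw [dist_eq_norm]
    have h6 := norm_add_le (x t - (z t).xe) ((z t).xe - xr)
    rw [sub_add_sub_cancel] at h6
    linarith
  · intro x u hcl h0
    obtain ⟨z, hz, hdec, hlow, hmono⟩ := hplans x u hcl h0
    set v₀ := ν.cost T xr (z 0) with hv₀
    have hS0 : ∀ t, 0 ≤ ν.total ν.S ((z t).xe - xr) := fun t => total_nonneg ν.S_posDef _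
    have hQ0 : ∀ t, 0 ≤ ν.total ν.Q (x t - (z t).xe) := fun t => total_nonneg ν.Q_posDef _
    have hv0 : 0 ≤ v₀ := by linarith [hlow 0, hS0 0, hQ0 0]
    have hQlim : Tendsto (fun t => ν.total ν.Q (x t - (z t).xe)) atTop (𝓝 0) :=
      tendsto_zero_of_decrease (v := fun t => ν.cost T xr (z t))
        (fun t => by linarith [hlow t, hS0 t, hQ0 t]) hQ0 hdec
    have hPlim : Tendsto (fun t => ν.total ν.P (x t - (z t).xe)) atTop (𝓝 0) := by
      have h1 : Tendsto (fun t => CP / cQ * ν.total ν.Q (x t - (z t).xe)) atTop (𝓝 0) := by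
        simpa using hQlim.const_mul (CP / cQ)
      refine squeeze_zero (fun t => total_nonneg ν.P_posDef _) (fun t => ?_) h1
      refine (hPb _).2.trans ?_
      have := mul_le_mul_of_nonneg_left (hQb (x t - (z t).xe)).1 (div_nonneg hCP.le hcQ.le)
      rwa [← mul_assoc, div_mul_cancel₀ _ hcQ.ne'] at this
    set κ := CP / cS with hκ
    have hκ0 : 0 < κ := div_pos hCP hcS
    have hPS : ∀ y, ν.total ν.P y ≤ κ * ν.total ν.S y := fun y => by
      refine (hPb y).2.trans ?_
      have := mul_le_mul_of_nonneg_left (hSb y).1 hκ0.le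
      rwa [← mul_assoc, hκ, div_mul_cancel₀ _ hcS.ne'] at this
    -- The first condition keeps the moved equilibrium a convex combination, the second makes the
    -- second-order terms in `β` at most half of the first-order gain, and the third keeps the state
    -- within the tracking radius `δ` of the moved equilibrium. None of them depends on time.
    obtain ⟨β, ⟨hβ1, hβ2, hβ3⟩, hβ⟩ := ((eventually_mul_le 1 one_pos).and
      ((eventually_mul_le (1 + 2 * κ) one_pos).and
        (eventually_mul_le (4 * κ * v₀) hδ)) |>.and self_mem_nhdsWithin).exists
    have hβ : 0 < β := hβ
    rw [one_mul] at hβ1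
    have hSlim : Tendsto (fun t => ν.total ν.S ((z t).xe - xr)) atTop (𝓝 0) := by
      have h1 : Tendsto (fun t => 2 / β * ν.total ν.P (x t - (z t).xe)) atTop (𝓝 0) := by
        simpa using hPlim.const_mul (2 / β)
      refine squeeze_zero' (Eventually.of_forall hS0) ?_ h1
      filter_upwards [(tendsto_order.mp hPlim).2 (δ / 4) (by positivity)] with t ht
      set xe := (z t).xe with hxe
      set D := ν.total ν.S (xe - xr) with hD
      have hDv : D ≤ v₀ := by linarith [hlow t, hQ0 t, hmono t]
      have hD0 : 0 ≤ D := hS0 t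
      have e1 : x t - ((1 - β) • xe + β • xr) = (x t - xe) + β • (xe - xr) := by module
      have e2 : (1 - β) • xe + β • xr - xr = (1 - β) • (xe - xr) := by module
      have h2 : ν.total ν.P (x t - ((1 - β) • xe + β • xr))
          ≤ 2 * ν.total ν.P (x t - xe) + 2 * (β ^ 2 * (κ * D)) := by
        rw [e1]
        refine (total_add_le ν.P_posDef _ _).trans ?_
        rw [total_smul]
        have := mul_le_mul_of_nonneg_left (hPS (xe - xr)) (sq_nonneg β)
        linarith
      have h3 : 2 * (β ^ 2 * (κ * D)) ≤ δ / 2 := by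
        have h4 : κ * D ≤ κ * v₀ := mul_le_mul_of_nonneg_left hDv hκ0.le
        have h5 : β ^ 2 ≤ β := by nlinarith
        have h6 : β ^ 2 * (κ * D) ≤ β * (κ * v₀) :=
          mul_le_mul h5 h4 (by positivity) hβ.le
        linarith
      obtain ⟨z', hz', hc'⟩ := hlocal _ _ ((hz t).1.admissible.convex htarget hβ.le hβ1) (x t)
        (by linarith)
      rw [e2, total_smul] at hc'
      have h4 := (hz t).2 z' hz'
      -- Optimality against the moved equilibrium. After rearranging, `(2β - (1 + 2κ)β²) D` is
      -- bounded by the tracking error, and the bracket is at least `β`.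
      have h5 : D ≤ 2 * ν.total ν.P (x t - xe) + 2 * (β ^ 2 * (κ * D)) + (1 - β) ^ 2 * D := by
        linarith [hlow t, hQ0 t]
      have h6 : β * D ≤ 2 * ν.total ν.P (x t - xe) := by
        have h7 : β * ((1 + 2 * κ) * β) * D ≤ β * 1 * D :=
          mul_le_mul_of_nonneg_right (mul_le_mul_of_nonneg_left hβ2 hβ.le) hD0
        nlinarith
      rw [div_mul_eq_mul_div, le_div_iff₀ hβ]
      linarith
    rw [tendsto_iff_norm_sub_tendsto_zero]
    have hsq : Tendsto (fun t => ‖x t - xr‖ ^ 2) atTop (𝓝 0) := by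
      have h1 : Tendsto (fun t => 2 / cQ * ν.total ν.Q (x t - (z t).xe)
          + 2 / cS * ν.total ν.S ((z t).xe - xr)) atTop (𝓝 0) := by
        simpa using (hQlim.const_mul (2 / cQ)).add (hSlim.const_mul (2 / cS))
      refine squeeze_zero (fun t => sq_nonneg _) (fun t => ?_) h1
      have h2 := (hQb (x t - (z t).xe)).1
      have h3 := (hSb ((z t).xe - xr)).1
      have h4 := norm_add_le (x t - (z t).xe) ((z t).xe - xr)
      rw [sub_add_sub_cancel] at h4
      have h5 : ‖x t - (z t).xe‖ ^ 2 ≤ ν.total ν.Q (x t - (z t).xe) / cQ := by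
        rw [le_div_iff₀ hcQ]; linarith
      have h6 : ‖(z t).xe - xr‖ ^ 2 ≤ ν.total ν.S ((z t).xe - xr) / cS := by
        rw [le_div_iff₀ hcS]; linarith
      have h7 : ‖x t - xr‖ ^ 2 ≤ 2 * ‖x t - (z t).xe‖ ^ 2 + 2 * ‖(z t).xe - xr‖ ^ 2 := by
        have := pow_le_pow_left₀ (norm_nonneg _) h4 2
        nlinarith [sq_nonneg (‖x t - (z t).xe‖ - ‖(z t).xe - xr‖)]
      have e : 2 / cQ * ν.total ν.Q (x t - (z t).xe) + 2 / cS * ν.total ν.S ((z t).xe - xr)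
          = 2 * (ν.total ν.Q (x t - (z t).xe) / cQ)
            + 2 * (ν.total ν.S ((z t).xe - xr) / cS) := by ring
      rw [e]
      linarith
    have := (Real.continuous_sqrt.tendsto 0).comp hsq
    simpa [Function.comp_def, Real.sqrt_sq (norm_nonneg _)] using this

/-! ### Existence of minimizers for bounded constraint sets -/

/-- A terminal constraint that depends continuously on centre and size. -/
def TerminalConstraint.Closed (Xf : TerminalConstraint) : Prop :=
  ∀ (d : ℕ) (P : Matrix (Fin d) (Fin d) ℝ),
    IsClosed {s : (Fin d → ℝ) × (Fin d → ℝ) × ℝ | s.1 ∈ Xf d P s.2.1 s.2.2}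

lemma ellipsoid_closed : TerminalConstraint.Closed ellipsoid := fun d P =>
  isClosed_le ((continuous_quad P).comp (by fun_prop)) (by fun_prop)

/-- The smallest possible slack `|x - c|` is the best one. Eliminating the existential quantifier
makes closedness visible. -/
lemma mem_dominated_iff {d : ℕ} {P : Matrix (Fin d) (Fin d) ℝ} {c x : Fin d → ℝ} {α : ℝ} :
    x ∈ dominated d P c α ↔ (∀ j, |x j - c j| + α * rowAbs P⁻¹ j ≤ 2 * α * P⁻¹ j j) ∧
      ∑ j, |x j - c j| ≤ α := by
  constructor
  · rintro ⟨bb, h1, h2, h3⟩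
    have h4 : ∀ j, |x j - c j| ≤ bb j := fun j => abs_le.mpr (h3 j)
    exact ⟨fun j => (add_le_add_left (h4 j) _).trans (h1 j),
      (Finset.sum_le_sum fun j _ => h4 j).trans h2⟩
  · rintro ⟨h1, h2⟩
    exact ⟨fun j => |x j - c j|, h1, h2, fun j => abs_le.mp le_rfl⟩

lemma dominated_closed : TerminalConstraint.Closed dominated := fun d P => by
  simp only [mem_dominated_iff, Set.ofPred_and, Set.ofPred_forall]
  exact (isClosed_iInter fun j => isClosed_le (by fun_prop) (by fun_prop)).inter
    (isClosed_le (by fun_prop) (by fun_prop))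

lemma invarianceConstraint_iff {i : ι} {α : ι → ℝ} {c : ν.StateIdx → ℝ} {d : ν.InputIdx → ℝ}
    {b : ν.StateIdx → ℝ} {mu : ι → ι → ℝ} : ν.InvarianceConstraint i α c d b mu ↔
    (∀ k, α i * rowAbs (ν.P i)⁻¹ k + ∑ l : ν.NbrIdx i, |ν.Acl i k l| * α l.1 + (ν.U i *ᵥ b) k
      ≤ 2 * α i * (ν.P i)⁻¹ k k) ∧
    (∀ k, |(ν.Acl i *ᵥ (ν.W i *ᵥ c) + ν.B i *ᵥ (ν.V i *ᵥ d) - ν.U i *ᵥ c) k| ≤ (ν.U i *ᵥ b) k) ∧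
    (∀ k : ν.NbrIdx i, ∑ j ∈ ν.N i, mu i j * rowAbs (ν.Pij i j) k + ∑ l, |ν.Acl i l k| * α k.1
      ≤ 2 * ∑ j ∈ ν.N i, mu i j * ν.Pij i j k k) ∧
    ∑ k, (ν.U i *ᵥ b) k ≤ α i - ∑ j ∈ ν.N i, mu i j ∧
    ∀ j ∈ ν.N i, 0 ≤ mu i j := by
  simp only [InvarianceConstraint, αN, Matrix.transpose_apply, Matrix.mul_diagonal,
    Matrix.map_apply]

/-- Needed for truncation: sizes outside the neighbourhood and all other multipliers may be changed
freely. -/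
lemma InvarianceConstraint.congr {i : ι} (hi : i ∈ ν.M) {α α' : ι → ℝ} {c : ν.StateIdx → ℝ}
    {d : ν.InputIdx → ℝ} {b : ν.StateIdx → ℝ} {mu mu' : ι → ι → ℝ}
    (h : ν.InvarianceConstraint i α c d b mu) (hα : ∀ j ∈ ν.N i, α' j = α j)
    (hmu : ∀ j ∈ ν.N i, mu' i j = mu i j) : ν.InvarianceConstraint i α' c d b mu' := by
  rw [invarianceConstraint_iff] at *
  obtain ⟨h1, h2, h3, h4, h5⟩ := h
  have e0 : ∑ j ∈ ν.N i, mu' i j = ∑ j ∈ ν.N i, mu i j := Finset.sum_congr rfl hmu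
  have e1 : ∀ f : ι → ℝ, ∑ j ∈ ν.N i, mu' i j * f j = ∑ j ∈ ν.N i, mu i j * f j := fun f =>
    Finset.sum_congr rfl fun j hj => by rw [hmu j hj]
  have e2 : ∀ l : ν.NbrIdx i, α' l.1 = α l.1 := fun l => hα l.1 l.1.2
  simp only [e0, e1, e2, hα i (ν.self_mem_N i hi)]
  exact ⟨h1, h2, h3, h4, fun j hj => by rw [hmu j hj]; exact h5 j hj⟩

/-- The decision variables as a point of a product space. -/
abbrev PlanSpace (ν : Network ι n m q r p) : Type _ :=
  (ℕ → ν.StateIdx → ℝ) × (ℕ → ν.InputIdx → ℝ) × (ν.StateIdx → ℝ) × (ν.InputIdx → ℝ) × (ι → ℝ) ×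
    (ν.StateIdx → ℝ) × (ν.InputIdx → ℝ) × (ν.StateIdx → ℝ) × (ι → ι → ℝ)

/-- The plan with the given decision variables. -/
def toPlan (y : ν.PlanSpace) : ν.Plan :=
  ⟨y.1, y.2.1, y.2.2.1, y.2.2.2.1, y.2.2.2.2.1, y.2.2.2.2.2.1, y.2.2.2.2.2.2.1, y.2.2.2.2.2.2.2.1,
    y.2.2.2.2.2.2.2.2⟩

lemma isClosed_next {Y : Type*} [TopologicalSpace Y] {x x' : Y → ν.StateIdx → ℝ}
    {u : Y → ν.InputIdx → ℝ} (hx : Continuous x) (hu : Continuous u) (hx' : Continuous x') :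
    IsClosed {y | ν.Next (x y) (u y) (x' y)} := by
  simp only [Next, Set.ofPred_forall]
  exact isClosed_iInter fun i => isClosed_iInter fun _ =>
    isClosed_eq (by fun_prop) (by fun_prop)

lemma isClosed_polytope {a b : Type*} [Fintype b] (G : Matrix a b ℝ) (g : a → ℝ) :
    IsClosed {x | G *ᵥ x ≤ g} := isClosed_le (by fun_prop) continuous_const

lemma isClosed_feasible {Xf : TerminalConstraint} (hXf : Xf.Closed) (T : ℕ)
    (x₀ : ν.StateIdx → ℝ) : IsClosed {y : ν.PlanSpace | ν.Feasible Xf T x₀ (toPlan y)} := by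
  have cx : ∀ t, Continuous fun y : ν.PlanSpace => (toPlan y).x t := fun t => by
    unfold toPlan; fun_prop
  have cu : ∀ t, Continuous fun y : ν.PlanSpace => (toPlan y).u t := fun t => by
    unfold toPlan; fun_prop
  have cxe : Continuous fun y : ν.PlanSpace => (toPlan y).xe := by unfold toPlan; fun_prop
  have cue : Continuous fun y : ν.PlanSpace => (toPlan y).ue := by unfold toPlan; fun_prop
  have cα : ∀ i, Continuous fun y : ν.PlanSpace => (toPlan y).α i := fun i => by
    unfold toPlan; fun_prop
  have cc : Continuous fun y : ν.PlanSpace => (toPlan y).c := by unfold toPlan; fun_prop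
  have cd : Continuous fun y : ν.PlanSpace => (toPlan y).d := by unfold toPlan; fun_prop
  have cb : Continuous fun y : ν.PlanSpace => (toPlan y).b := by unfold toPlan; fun_prop
  have cmu : ∀ i j, Continuous fun y : ν.PlanSpace => (toPlan y).mu i j := fun i j => by
    unfold toPlan; fun_prop
  -- Written as a conjunction, feasibility defines an intersection of sets, each closed by
  -- continuity in the decision variables.
  have hiff : ∀ z : ν.Plan, ν.Feasible Xf T x₀ z ↔ z.x 0 = x₀ ∧
      (∀ t < T, ν.Next (z.x t) (z.u t) (z.x (t + 1))) ∧
      (∀ t ≤ T, ∀ i ∈ ν.M, ν.U i *ᵥ z.x t ∈ ν.X i) ∧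
      (∀ t < T, ∀ i ∈ ν.M, ν.V i *ᵥ z.u t ∈ ν.Uset i) ∧
      ν.Next z.xe z.ue z.xe ∧
      (∀ i ∈ ν.M, ν.U i *ᵥ z.xe ∈ ν.lam i • ν.X i) ∧
      (∀ i ∈ ν.M, ν.V i *ᵥ z.ue = ν.K i *ᵥ (ν.U i *ᵥ z.xe) + ν.V i *ᵥ z.d) ∧
      (∀ i ∈ ν.M, ν.V i *ᵥ z.ue ∈ ν.lam i • ν.Uset i) ∧
      (∀ i ∈ ν.M, 0 ≤ z.α i) ∧
      (∀ i ∈ ν.M, ν.U i *ᵥ z.x T ∈ Xf (n i) (ν.P i) (ν.U i *ᵥ z.c) (z.α i)) ∧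
      (∀ i ∈ ν.M, ν.InvarianceConstraint i z.α z.c z.d z.b z.mu) ∧
      (∀ i ∈ ν.M, ∀ k, ν.G i k ⬝ᵥ (ν.U i *ᵥ z.c)
        + √(ν.G i k ⬝ᵥ ((ν.P i)⁻¹ *ᵥ ν.G i k)) * z.α i ≤ ν.g i k) ∧
      (∀ i ∈ ν.M, ∀ l, ν.H i l ⬝ᵥ (ν.K i *ᵥ (ν.U i *ᵥ z.c)) + ν.H i l ⬝ᵥ (ν.V i *ᵥ z.d)
        + √((ν.H i l ᵥ* ν.K i) ⬝ᵥ ((ν.P i)⁻¹ *ᵥ (ν.H i l ᵥ* ν.K i))) * z.α i ≤ ν.h i l) :=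
    fun z => ⟨fun ⟨a1, a2, a3, a4, a5, a6, a7, a8, a9, a10, a11, a12, a13⟩ =>
      ⟨a1, a2, a3, a4, a5, a6, a7, a8, a9, a10, a11, a12, a13⟩,
      fun ⟨a1, a2, a3, a4, a5, a6, a7, a8, a9, a10, a11, a12, a13⟩ =>
      ⟨a1, a2, a3, a4, a5, a6, a7, a8, a9, a10, a11, a12, a13⟩⟩
  simp only [hiff, invarianceConstraint_iff, Set.ofPred_and, Set.ofPred_forall]
  refine IsClosed.inter (isClosed_eq (cx 0) continuous_const) <|
    IsClosed.inter (isClosed_iInter fun t => isClosed_iInter fun _ =>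
      isClosed_next (cx t) (cu t) (cx (t + 1))) <|
    IsClosed.inter (isClosed_iInter fun t => isClosed_iInter fun _ => isClosed_iInter fun i =>
      isClosed_iInter fun _ => (isClosed_polytope (ν.G i) (ν.g i)).preimage (by fun_prop)) <|
    IsClosed.inter (isClosed_iInter fun t => isClosed_iInter fun _ => isClosed_iInter fun i =>
      isClosed_iInter fun _ => (isClosed_polytope (ν.H i) (ν.h i)).preimage (by fun_prop)) <|
    IsClosed.inter (isClosed_next cxe cue cxe) <|
    IsClosed.inter (isClosed_iInter fun i => isClosed_iInter fun hi =>
      ((isClosed_polytope (ν.G i) (ν.g i)).smul_of_ne_zero (ν.lam_mem i hi).1.ne').preimage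
        (by fun_prop)) <|
    IsClosed.inter (isClosed_iInter fun i => isClosed_iInter fun _ =>
      isClosed_eq (by fun_prop) (by fun_prop)) <|
    IsClosed.inter (isClosed_iInter fun i => isClosed_iInter fun hi =>
      ((isClosed_polytope (ν.H i) (ν.h i)).smul_of_ne_zero (ν.lam_mem i hi).1.ne').preimage
        (by fun_prop)) <|
    IsClosed.inter (isClosed_iInter fun i => isClosed_iInter fun _ =>
      isClosed_le continuous_const (cα i)) <|
    IsClosed.inter (isClosed_iInter fun i => isClosed_iInter fun _ =>
      (hXf (n i) (ν.P i)).preimage (f := fun y : ν.PlanSpace =>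
        (ν.U i *ᵥ (toPlan y).x T, ν.U i *ᵥ (toPlan y).c, (toPlan y).α i)) (by fun_prop)) <|
    IsClosed.inter (isClosed_iInter fun i => isClosed_iInter fun _ => ?_) <|
    IsClosed.inter (isClosed_iInter fun i => isClosed_iInter fun _ => isClosed_iInter fun k =>
      isClosed_le (by fun_prop) continuous_const) <|
    isClosed_iInter fun i => isClosed_iInter fun _ => isClosed_iInter fun k =>
      isClosed_le (by fun_prop) continuous_const
  refine IsClosed.inter (isClosed_iInter fun k => isClosed_le ?_ ?_) <|
    IsClosed.inter (isClosed_iInter fun k => isClosed_le ?_ ?_) <|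
    IsClosed.inter (isClosed_iInter fun k => isClosed_le ?_ ?_) <|
    IsClosed.inter (isClosed_le ?_ ?_) <|
    isClosed_iInter fun j => isClosed_iInter fun _ => isClosed_le continuous_const (cmu i j)
  all_goals fun_prop

lemma continuous_cost (T : ℕ) (xr : ν.StateIdx → ℝ) :
    Continuous fun y : ν.PlanSpace => ν.cost T xr (toPlan y) := by
  simp only [cost_eq, stage, toPlan]
  have h1 := fun X => continuous_total (ν := ν) X
  have h2 := fun X => continuous_totalInput (ν := ν) X
  fun_prop

/-- A plan with the irrelevant decision variables set to zero. -/
def truncate (T : ℕ) (z : ν.Plan) : ν.PlanSpace :=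
  (fun t => if t ≤ T then z.x t else 0, fun t => if t < T then z.u t else 0, z.xe, z.ue,
    fun i => if i ∈ ν.M then z.α i else 0, z.c, z.d, z.b,
    fun i j => if i ∈ ν.M ∧ j ∈ ν.N i then z.mu i j else 0)

lemma cost_truncate (T : ℕ) (xr : ν.StateIdx → ℝ) (z : ν.Plan) :
    ν.cost T xr (toPlan (truncate T z)) = ν.cost T xr z := by
  simp only [cost_eq, toPlan, truncate, le_refl, if_true]
  congr 2
  refine Finset.sum_congr rfl fun t ht => ?_
  have ht := Finset.mem_range.mp ht
  rw [if_pos ht.le, if_pos ht]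

lemma Feasible.truncate {Xf : TerminalConstraint} {T : ℕ} {x₀ : ν.StateIdx → ℝ} {z : ν.Plan}
    (h : ν.Feasible Xf T x₀ z) : ν.Feasible Xf T x₀ (toPlan (truncate T z)) where
  init := by simpa [toPlan, Network.truncate] using h.init
  dyn t ht := by
    simpa only [toPlan, Network.truncate, if_pos ht.le, if_pos ht, if_pos (Nat.succ_le_of_lt ht)]
      using h.dyn t ht
  state t ht i hi := by simpa only [toPlan, Network.truncate, if_pos ht] using h.state t ht i hi
  input t ht i hi := by simpa only [toPlan, Network.truncate, if_pos ht] using h.input t ht i hi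
  eq_dyn := h.eq_dyn
  eq_state := h.eq_state
  eq_ctrl := h.eq_ctrl
  eq_input := h.eq_input
  size i hi := by simpa only [toPlan, Network.truncate, if_pos hi] using h.size i hi
  terminal i hi := by
    simpa only [toPlan, Network.truncate, if_pos hi, if_pos le_rfl] using h.terminal i hi
  invariance i hi := (h.invariance i hi).congr hi
    (fun j hj => by simp only [toPlan, Network.truncate, if_pos (ν.N_subset i hi hj)])
    (fun j hj => by simp only [toPlan, Network.truncate, if_pos (And.intro hi hj)])
  term_state i hi := by
    simpa only [toPlan, Network.truncate, if_pos hi] using h.term_state i hi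
  term_input i hi := by
    simpa only [toPlan, Network.truncate, if_pos hi] using h.term_input i hi

lemma isCompact_box {κ : Type*} (R : ℝ) : IsCompact {f : κ → ℝ | ∀ k, |f k| ≤ R} := by
  have : {f : κ → ℝ | ∀ k, |f k| ≤ R} = Set.pi Set.univ fun _ => Set.Icc (-R) R := by
    ext f; simp only [Set.mem_ofPred_eq, Set.mem_univ_pi, Set.mem_Icc, abs_le]
  rw [this]
  exact isCompact_univ_pi fun _ => isCompact_Icc

lemma isCompact_box₂ {κ κ' : Type*} (R : ℝ) :
    IsCompact {f : κ → κ' → ℝ | ∀ k l, |f k l| ≤ R} := by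
  have : {f : κ → κ' → ℝ | ∀ k l, |f k l| ≤ R}
      = Set.pi Set.univ fun _ => {f : κ' → ℝ | ∀ l, |f l| ≤ R} := by
    ext f; simp
  rw [this]
  exact isCompact_univ_pi fun _ => isCompact_box R

/-- A box in the space of decision variables. -/
def planBox (ν : Network ι n m q r p) (Rx Ru Rd Ra : ℝ) : Set ν.PlanSpace :=
  {f : ℕ → ν.StateIdx → ℝ | ∀ k l, |f k l| ≤ Rx} ×ˢ
    {f : ℕ → ν.InputIdx → ℝ | ∀ k l, |f k l| ≤ Ru} ×ˢ
    {f : ν.StateIdx → ℝ | ∀ k, |f k| ≤ Rx} ×ˢ {f : ν.InputIdx → ℝ | ∀ k, |f k| ≤ Ru} ×ˢ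
    {f : ι → ℝ | ∀ k, |f k| ≤ Ra} ×ˢ {f : ν.StateIdx → ℝ | ∀ k, |f k| ≤ Rx} ×ˢ
    {f : ν.InputIdx → ℝ | ∀ k, |f k| ≤ Rd} ×ˢ {f : ν.StateIdx → ℝ | ∀ k, |f k| ≤ Ra} ×ˢ
    {f : ι → ι → ℝ | ∀ k l, |f k l| ≤ Ra}

lemma exists_bound_of_isBounded {κ : Type*} {d : κ → ℕ} (M : Finset κ) {s : ∀ i, Set (Fin (d i) → ℝ)}
    (h : ∀ i ∈ M, Bornology.IsBounded (s i)) :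
    ∃ R, 0 ≤ R ∧ ∀ i ∈ M, ∀ v ∈ s i, ‖v‖ ≤ R := by
  have : ∀ᶠ R : ℝ in atTop, ∀ i ∈ M, ∀ v ∈ s i, ‖v‖ ≤ R := by
    rw [Filter.eventually_all_finset]
    intro i hi
    obtain ⟨R, hR⟩ := isBounded_iff_forall_norm_le.mp (h i hi)
    exact (eventually_ge_atTop R).mono fun R' h' v hv => (hR v hv).trans h'
  obtain ⟨R, hR, h0⟩ := (this.and (eventually_ge_atTop 0)).exists
  exact ⟨R, h0, hR⟩

/-- For bounded constraint sets, the relevant decision variables are bounded. -/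
lemma exists_bound_of_feasible (hn : ∀ i, 0 < n i) {Xf : TerminalConstraint} (T : ℕ)
    (hb : ∀ i ∈ ν.M, Bornology.IsBounded (ν.X i) ∧ Bornology.IsBounded (ν.Uset i)) :
    ∃ Rx Ru Rd Ra : ℝ, 0 ≤ Rx ∧ 0 ≤ Ru ∧ 0 ≤ Ra ∧ ∀ x₀ z, ν.Feasible Xf T x₀ z →
      (∀ t ≤ T, ∀ s, |z.x t s| ≤ Rx) ∧ (∀ t < T, ∀ s, |z.u t s| ≤ Ru) ∧ (∀ s, |z.xe s| ≤ Rx) ∧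
      (∀ s, |z.ue s| ≤ Ru) ∧ (∀ i ∈ ν.M, |z.α i| ≤ Ra) ∧ (∀ s, |z.c s| ≤ Rx) ∧
      (∀ s, |z.d s| ≤ Rd) ∧ (∀ s, |z.b s| ≤ Ra) ∧
      ∀ i ∈ ν.M, ∀ j ∈ ν.N i, |z.mu i j| ≤ Ra := by
  obtain ⟨Rx, hRx, hx⟩ := exists_bound_of_isBounded ν.M fun i hi => (hb i hi).1
  obtain ⟨Ru, hRu, hu⟩ := exists_bound_of_isBounded ν.M fun i hi => (hb i hi).2
  have hcx : ∀ (x : ν.StateIdx → ℝ), (∀ i ∈ ν.M, ‖ν.U i *ᵥ x‖ ≤ Rx) → ∀ s, |x s| ≤ Rx := by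
    rintro x h ⟨⟨i, hi⟩, a⟩
    have := (norm_le_pi_norm _ a).trans (h i hi)
    rwa [ν.U_mulVec hi] at this
  have hcu : ∀ (x : ν.InputIdx → ℝ), (∀ i ∈ ν.M, ‖ν.V i *ᵥ x‖ ≤ Ru) → ∀ s, |x s| ≤ Ru := by
    rintro x h ⟨⟨i, hi⟩, a⟩
    have := (norm_le_pi_norm _ a).trans (h i hi)
    rwa [ν.V_mulVec hi] at this
  have hlamx : ∀ i ∈ ν.M, ∀ v ∈ ν.lam i • ν.X i, ‖v‖ ≤ Rx := by
    rintro i hi _ ⟨v, hv, rfl⟩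
    have hl := ν.lam_mem i hi
    simp only [norm_smul, Real.norm_of_nonneg hl.1.le]
    exact (mul_le_of_le_one_left (norm_nonneg v) hl.2.le).trans (hx i hi v hv)
  have hlamu : ∀ i ∈ ν.M, ∀ v ∈ ν.lam i • ν.Uset i, ‖v‖ ≤ Ru := by
    rintro i hi _ ⟨v, hv, rfl⟩
    have hl := ν.lam_mem i hi
    simp only [norm_smul, Real.norm_of_nonneg hl.1.le]
    exact (mul_le_of_le_one_left (norm_nonneg v) hl.2.le).trans (hu i hi v hv)
  set κ : ι → ℝ := fun i => √(ν.P i ⟨0, hn i⟩ ⟨0, hn i⟩) * (2 * Rx) with hκ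
  have hκ0 : ∀ i, 0 ≤ κ i := fun i => by positivity
  set RK : ℝ := ∑ s : ν.InputIdx, ∑ l, |ν.K s.1 s.2 l| * Rx with hRK
  refine ⟨Rx, Ru, Ru + RK, ∑ i ∈ ν.M, κ i, hRx, hRu, Finset.sum_nonneg fun i _ => hκ0 i,
    fun x₀ z hz => ?_⟩
  have hp := hz.terminalParams
  have hc : ∀ i ∈ ν.M, ‖ν.U i *ᵥ z.c‖ ≤ Rx := fun i hi =>
    hx i hi _ (hp.mem_X hi (by rw [sub_self, quad_zero]; positivity))
  have hxe : ∀ s, |z.xe s| ≤ Rx := hcx _ fun i hi => hlamx i hi _ (hz.eq_state i hi)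
  have hue : ∀ s, |z.ue s| ≤ Ru := hcu _ fun i hi => hlamu i hi _ (hz.eq_input i hi)
  have hα : ∀ i ∈ ν.M, z.α i ≤ ∑ i ∈ ν.M, κ i := fun i hi => by
    refine le_trans ?_ (Finset.single_le_sum (fun j _ => hκ0 j) hi)
    set o : Fin (n i) := ⟨0, hn i⟩ with ho
    have hPo : 0 < ν.P i o o := (ν.P_posDef i hi).diag_pos
    -- This point lies on the boundary of the ellipsoid, in the direction of the first coordinate,
    -- which exists since `0 < n i`. The ellipsoid is contained in the bounded set `X i`, so the
    -- size is bounded by the distance of the point from the centre.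
    have hv : quad (ν.P i) ((ν.U i *ᵥ z.c + Pi.single o (z.α i / √(ν.P i o o))) - ν.U i *ᵥ z.c)
        ≤ z.α i ^ 2 := by
      rw [add_sub_cancel_left, quad, single_dotProduct, Matrix.mulVec_single]
      simp only [Pi.smul_apply, MulOpposite.smul_eq_mul_unop, MulOpposite.unop_op, Matrix.col_apply]
      apply le_of_eq
      have h1 := Real.sq_sqrt hPo.le
      have h2 : √(ν.P i o o) ≠ 0 := (Real.sqrt_pos.mpr hPo).ne'
      field_simp
      rw [h1]
    have h3 := (norm_le_pi_norm _ o).trans (hx i hi _ (hp.mem_X hi hv))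
    have h4 := (norm_le_pi_norm _ o).trans (hc i hi)
    rw [Real.norm_eq_abs, abs_le] at h3 h4
    simp only [Pi.add_apply, Pi.single_eq_same] at h3
    have h5 : z.α i / √(ν.P i o o) ≤ 2 * Rx := by linarith
    rw [div_le_iff₀ (Real.sqrt_pos.mpr hPo)] at h5
    simp only [hκ]
    linarith
  have hbk : ∀ i ∈ ν.M, ∀ k, 0 ≤ (ν.U i *ᵥ z.b) k := fun i hi k =>
    (abs_nonneg _).trans ((hz.invariance i hi).2.1 k)
  have hsum : ∀ i ∈ ν.M, ∑ k, (ν.U i *ᵥ z.b) k ≤ z.α i - ∑ j ∈ ν.N i, z.mu i j := fun i hi =>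
    (hz.invariance i hi).2.2.2.1
  have hmu : ∀ i ∈ ν.M, ∀ j ∈ ν.N i, 0 ≤ z.mu i j := fun i hi => (hz.invariance i hi).2.2.2.2
  refine ⟨fun t ht => hcx _ fun i hi => hx i hi _ (hz.state t ht i hi),
    fun t ht => hcu _ fun i hi => hu i hi _ (hz.input t ht i hi), hxe, hue,
    fun i hi => by rw [abs_of_nonneg (hz.size i hi)]; exact hα i hi, hcx _ hc, fun s => ?_, ?_,
    fun i hi j hj => ?_⟩
  · have e : z.d s = z.ue s - ν.gain z.xe s := by rw [hz.ue_eq]; simp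
    rw [e]
    refine (abs_sub _ _).trans (add_le_add (hue s) ?_)
    have h1 : |ν.gain z.xe s| ≤ ∑ l, |ν.K s.1 s.2 l| * Rx := by
      rw [gain, Matrix.mulVec, dotProduct]
      refine (Finset.abs_sum_le_sum_abs _ _).trans (Finset.sum_le_sum fun l _ => ?_)
      rw [abs_mul]
      refine mul_le_mul_of_nonneg_left ?_ (abs_nonneg _)
      rw [ν.U_mulVec s.1.2]
      exact hxe _
    exact h1.trans (Finset.single_le_sum
      (f := fun s : ν.InputIdx => ∑ l, |ν.K s.1 s.2 l| * Rx)
      (fun s _ => Finset.sum_nonneg fun l _ => by positivity) (Finset.mem_univ s))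
  · rintro ⟨⟨i, hi⟩, k⟩
    have h1 := Finset.single_le_sum (f := fun k => (ν.U i *ᵥ z.b) k) (fun k _ => hbk i hi k)
      (Finset.mem_univ k)
    have h2 := hbk i hi k
    have h3 := Finset.sum_nonneg (hmu i hi)
    have h4 := hsum i hi
    rw [ν.U_mulVec hi] at h1 h2 h4
    simp only at h1 h2 h4
    rw [abs_of_nonneg h2]
    linarith [hα i hi]
  · have h1 := Finset.single_le_sum (hmu i hi) hj
    have h2 := Finset.sum_nonneg fun k (_ : k ∈ Finset.univ) => hbk i hi k
    rw [abs_of_nonneg (hmu i hi j hj)]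
    linarith [hα i hi, hsum i hi]

/-- For bounded constraint sets the optimal control problem has a minimizer when it is feasible. -/
lemma exists_optimal (hn : ∀ i, 0 < n i) {Xf : TerminalConstraint} (hXf : Xf.Closed) (T : ℕ)
    (xr : ν.StateIdx → ℝ)
    (hb : ∀ i ∈ ν.M, Bornology.IsBounded (ν.X i) ∧ Bornology.IsBounded (ν.Uset i))
    {x₀ : ν.StateIdx → ℝ} (hx₀ : x₀ ∈ ν.feasibleStates Xf T) :
    ∃ z, ν.Optimal Xf T xr x₀ z := by
  obtain ⟨Rx, Ru, Rd, Ra, hRx, hRu, hRa, hR⟩ := exists_bound_of_feasible (Xf := Xf) hn T hb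
  -- The time index and possibly `ι` are infinite, so compactness is in the product topology, by
  -- Tychonoff's theorem.
  have hcomp : IsCompact (planBox ν Rx Ru Rd Ra) :=
    (isCompact_box₂ Rx).prod <| (isCompact_box₂ Ru).prod <| (isCompact_box Rx).prod <|
      (isCompact_box Ru).prod <| (isCompact_box Ra).prod <| (isCompact_box Rx).prod <|
      (isCompact_box Rd).prod <| (isCompact_box Ra).prod <| isCompact_box₂ Ra
  have hK := hcomp.inter_right (isClosed_feasible hXf T x₀)
  have hmem : ∀ z, ν.Feasible Xf T x₀ z → truncate T z ∈ planBox ν Rx Ru Rd Ra ∩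
      {y : ν.PlanSpace | ν.Feasible Xf T x₀ (toPlan y)} := by
    intro z hz
    obtain ⟨b1, b2, b3, b4, b5, b6, b7, b8, b9⟩ := hR x₀ z hz
    refine ⟨⟨fun t s => ?_, fun t s => ?_, b3, b4, fun i => ?_, b6, b7, b8, fun i j => ?_⟩,
      hz.truncate⟩
    · by_cases h : t ≤ T
      · simpa only [truncate, if_pos h] using b1 t h s
      · simpa only [truncate, if_neg h, Pi.zero_apply, abs_zero] using hRx
    · by_cases h : t < T
      · simpa only [truncate, if_pos h] using b2 t h s
      · simpa only [truncate, if_neg h, Pi.zero_apply, abs_zero] using hRu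
    · by_cases h : i ∈ ν.M
      · simpa only [truncate, if_pos h] using b5 i h
      · simpa only [truncate, if_neg h, abs_zero] using hRa
    · by_cases h : i ∈ ν.M ∧ j ∈ ν.N i
      · simpa only [truncate, if_pos h] using b9 i h.1 j h.2
      · simpa only [truncate, if_neg h, abs_zero] using hRa
  obtain ⟨z₀, hz₀⟩ := hx₀
  obtain ⟨y, hy, hmin⟩ := hK.exists_isMinOn ⟨_, hmem z₀ hz₀⟩ (continuous_cost T xr).continuousOn
  refine ⟨toPlan y, hy.2, fun z' hz' => ?_⟩
  rw [← cost_truncate T xr z']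
  exact hmin (hmem z' hz')

/-! ### Stability for the two terminal constraints -/

lemma eventually_total_le (X : ∀ i, Matrix (Fin (n i)) (Fin (n i)) ℝ) (xr : ν.StateIdx → ℝ)
    {δ : ℝ} (hδ : 0 < δ) : ∀ᶠ x in 𝓝 xr, ν.total X (x - xr) ≤ δ := by
  have h : Tendsto (fun x => ν.total X (x - xr)) (𝓝 xr) (𝓝 (ν.total X (xr - xr))) :=
    ((continuous_total (ν := ν) X).comp (continuous_id.sub continuous_const)).tendsto xr
  rw [sub_self, total_zero] at h
  exact ((tendsto_order.mp h).2 δ hδ).mono fun _ h => h.le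

variable {T : ℕ} {xr : ν.StateIdx → ℝ} {ur : ν.InputIdx → ℝ}

/-- With ellipsoidal terminal sets, the closed loop is asymptotically stable on the feasible
set. -/
lemma asymptoticallyStable_ellipsoid (hn : ∀ i, 0 < n i) (hlmi : ∀ i ∈ ν.M, ν.LocalLMI i)
    (hT : 1 ≤ T) (hX : ∀ i ∈ ν.M, (0 : Fin (n i) → ℝ) ∈ interior (ν.X i))
    (hU : ∀ i ∈ ν.M, (0 : Fin (m i) → ℝ) ∈ interior (ν.Uset i))
    (hterm : ν.NondegenerateTerminalSets) (htarget : ν.AdmissibleTarget xr ur) :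
    ν.AsymptoticallyStable ellipsoid T xr (ν.feasibleStates ellipsoid T) := by
  obtain ⟨δ, hδ, α, mu, hparams, hloc⟩ := exists_uniform_terminal hX hU hterm
  have hlocal : ∀ xe ue, ν.AdmissibleTarget xe ue → ∀ x, ν.total ν.P (x - xe) ≤ δ →
      ∃ z, ν.Feasible ellipsoid T x z ∧
        ν.cost T xr z ≤ ν.total ν.P (x - xe) + ν.total ν.S (xe - xr) := by
    intro xe ue had x hx
    obtain ⟨z, hz, hc⟩ := exists_local_plan hlmi hT had (hparams xe ue had) hloc xr hx
    exact ⟨z, hz.to_ellipsoid, hc⟩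
  refine asymptoticallyStable_of_decrease hT htarget ?_ subset_rfl
    (fun hb x hx => exists_optimal hn ellipsoid_closed T xr hb hx) hδ hlocal ?_
  · filter_upwards [eventually_total_le ν.P xr hδ] with x hx
    obtain ⟨z, hz, -⟩ := hlocal xr ur htarget x hx
    exact ⟨z, hz⟩
  · intro x _ z hz
    -- Joint invariance of the plan's own ellipsoids; the shifted plan therefore keeps all its
    -- terminal parameters.
    have hnext : ∀ i ∈ ν.M, quad (ν.P i)
        (ν.U i *ᵥ (z.xe + ν.clStep (z.x T - z.xe)) - ν.U i *ᵥ z.c) ≤ z.α i ^ 2 := fun i hi => by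
      have h1 := (hz.1.invariance i hi).quad_le hi
        (fun j hj => hz.1.size j (ν.N_subset i hi hj)) (e := z.x T - z.c) (fun j hj => by
          rw [Matrix.mulVec_sub]
          exact hz.1.terminal j (ν.N_subset i hi hj))
      rw [← hz.1.step_terminal, U_step hi, Matrix.mulVec_add, V_gain hi, Matrix.mulVec_add,
        ← add_assoc, ← Acl_mulVec_W hi]
      rw [Matrix.mulVec_sub, Matrix.mulVec_sub] at h1
      convert h1 using 2
      abel
    obtain ⟨z', hz', hc⟩ := hz.1.shift hlmi hT xr hz.1.terminalParams hz.1.terminal hnext hnext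
    exact ⟨⟨z', hz'⟩, z', hz', hc⟩

/-- With polyhedral terminal sets, the closed loop is asymptotically stable on a sublevel set of
the optimal cost. -/
lemma exists_asymptoticallyStable_dominated (hn : ∀ i, 0 < n i)
    (hlmi : ∀ i ∈ ν.M, ν.LocalLMI i) (hT : 1 ≤ T)
    (hX : ∀ i ∈ ν.M, (0 : Fin (n i) → ℝ) ∈ interior (ν.X i))
    (hU : ∀ i ∈ ν.M, (0 : Fin (m i) → ℝ) ∈ interior (ν.Uset i))
    (hterm : ν.NondegenerateTerminalSets) (htarget : ν.AdmissibleTarget xr ur) :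
    ∃ E, ν.AsymptoticallyStable dominated T xr E := by
  obtain ⟨δ, hδ, α, mu, hparams, hloc⟩ := exists_uniform_terminal hX hU hterm
  have hlocal : ∀ xe ue, ν.AdmissibleTarget xe ue → ∀ x, ν.total ν.P (x - xe) ≤ δ →
      ∃ z, ν.Feasible dominated T x z ∧
        ν.cost T xr z ≤ ν.total ν.P (x - xe) + ν.total ν.S (xe - xr) :=
    fun xe ue had x hx => exists_local_plan hlmi hT had (hparams xe ue had) hloc xr hx
  have hfeas : {x | ∃ z, ν.Feasible dominated T x z ∧ ν.cost T xr z ≤ δ}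
      ⊆ ν.feasibleStates dominated T := fun x ⟨z, hz, _⟩ => ⟨z, hz⟩
  refine ⟨{x | ∃ z, ν.Feasible dominated T x z ∧ ν.cost T xr z ≤ δ},
    asymptoticallyStable_of_decrease hT htarget ?_ hfeas
      (fun hb x hx => exists_optimal hn dominated_closed T xr hb (hfeas hx)) hδ hlocal ?_⟩
  · filter_upwards [eventually_total_le ν.P xr hδ] with x hx
    obtain ⟨z, hz, hc⟩ := hlocal xr ur htarget x hx
    rw [sub_self, total_zero, add_zero] at hc
    exact ⟨z, hz, hc.trans hx⟩
  · rintro x ⟨z₁, hz₁, hc₁⟩ z hz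
    have hcost : ν.cost T xr z ≤ δ := (hz.2 z₁ hz₁).trans hc₁
    -- On the sublevel set the predicted final state is close to the artificial equilibrium. The
    -- shifted plan can then discard its old terminal sets for the uniform ones centred at `z.xe`,
    -- with the same offset `z.d`.
    have hdist : ν.total ν.P (z.x T - z.xe) ≤ δ := (total_P_le_cost T xr z).trans hcost
    have hp := hparams z.xe z.ue hz.1.admissible
    have hd : z.ue - ν.gain z.xe = z.d := by rw [hz.1.ue_eq, add_sub_cancel_left]
    rw [hd] at hp
    obtain ⟨z', hz', hc⟩ := hz.1.shift hlmi hT xr hp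
      (fun i hi => by
        rw [← Matrix.mulVec_sub]
        exact (hloc _ hdist i hi).1)
      (fun i hi => by
        rw [← Matrix.mulVec_sub, add_sub_cancel_left]
        exact (hloc _ ((total_clStep_le_total hlmi _).trans hdist) i hi).1)
      (fun i hi => (hloc _ hdist i hi).2 z.xe)
    exact ⟨⟨z', hz', by linarith [total_nonneg ν.Q_posDef (x - z.xe)]⟩, z', hz', hc⟩

end Network

theorem theorem2 {ι : Type*} [DecidableEq ι] {n m q r : ι → ℕ} {p : ℕ} (hn : ∀ i, 0 < n i)
    -- the networks before any request and after the first, the second, … request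
    (k : ℕ) (net : ℕ → Network ι n m q r p)
    (hinit : (net 0).InitialAssumption)
    (hreq : ∀ s < k, Network.PnPRequest (net s) (net (s + 1)))
    -- after each request, the joining and affected subsystems and their neighbours are redesigned
    (hlmi : ∀ s < k, ∀ i ∈ Network.redesignSet (net s) (net (s + 1)), (net (s + 1)).LocalLMI i)
    -- the controller of the `k`-th network
    (T : ℕ) (hT : 1 ≤ T)
    (hX : ∀ i ∈ (net k).M, (0 : Fin (n i) → ℝ) ∈ interior ((net k).X i))
    (hU : ∀ i ∈ (net k).M, (0 : Fin (m i) → ℝ) ∈ interior ((net k).Uset i))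
    (hterm : (net k).NondegenerateTerminalSets)
    (xr : (net k).StateIdx → ℝ) (ur : (net k).InputIdx → ℝ)
    (htarget : (net k).AdmissibleTarget xr ur) :
    -- terminal sets are ellipsoids: stability on the whole feasible set
    (net k).AsymptoticallyStable Network.ellipsoid T xr
        ((net k).feasibleStates Network.ellipsoid T) ∧
    -- terminal sets are the polyhedral inner approximations: stability on a neighbourhood
    ∃ E, (net k).AsymptoticallyStable Network.dominated T xr E := by

  obtain ⟨Γ, D, ε, hinit⟩ := hinit
  have h := Network.localLMI_of_requests
    (fun i hi => (hinit ⟨i, hi⟩).2.2.2.2.2.2.2.2) hreq hlmi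
  exact ⟨Network.asymptoticallyStable_ellipsoid hn h hT hX hU hterm htarget,
    Network.exists_asymptoticallyStable_dominated hn h hT hX hU hterm htarget⟩
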